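/- For a prime $q$ let $\mathcal{X}_q$ be the group of all Dirichlet characters modulo $q$ (including the principal one), and put $\mathcal{L}(q)=\sqrt{\log q/\log\log q}$. Let $(q_i,H_i)$ be any family of pairs, where $q_i$ is a prime and $H_i\le\mathcal{X}_{q_i}$ is a subgroup, such that in the limit over $i$ (along a sequence or, more generally, along any filter on the index set) $$q_i\to\infty\qquad\text{and}\qquad \log[\mathcal{X}_{q_i}:H_i]=o(\mathcal{L}(q_i)).$$ Then $$\max_{\chi\in H_i}|L(\chi,1/2)|\ge\exp\left(\left(\frac{1}{\sqrt3}+o(1)\right)\mathcal{L}(q_i)\right),$$ where $L(\chi,s)$ is the analytically continued Dirichlet $L$-function of $\chi$; that is, there are real numbers $\epsilon_i\to0$ such that eventually $\max_{\chi\in H_i}|L(\chi,1/2)|\ge\exp((1/\sqrt3+\epsilon_i)\mathcal{L}(q_i))$. Equivalently, for every $\varepsilon>0$ there are $\delta>0$ and $q_0$ such that for every prime $q\ge q_0$ and every subgroup $H\le\mathcal{X}_q$ with $\log[\mathcal{X}_q:H]\le\delta\mathcal{L}(q)$ one has $\max_{\chi\in H}|L(\chi,1/2)|\ge\exp((1/\sqrt3-\varepsilon)\mathcal{L}(q))$.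 -/

import Mathlib

open Filter Asymptotics Topology

/-- The scale `𝓛(q) = √(log q / log log q)`. -/
noncomputable def resonanceScale (q : ℕ) : ℝ :=
  Real.sqrt (Real.log q / Real.log (Real.log q))

/-- The maximum of `|L(χ, 1/2)|` over the characters `χ` in a subgroup `H` of the group of all
Dirichlet characters modulo `q`. -/
noncomputable def maxCentralValue {q : ℕ} [NeZero q]
    (H : Subgroup (DirichletCharacter ℂ q)) : ℝ :=
  ⨆ χ : H, ‖DirichletCharacter.LFunction (χ : DirichletCharacter ℂ q) (1 / 2)‖

/-- The supremum in `maxCentralValue` is over a finite nonempty set, hence a genuine maximum. -/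
theorem maxCentralValue_isGreatest {q : ℕ} [NeZero q]
    (H : Subgroup (DirichletCharacter ℂ q)) :
    IsGreatest ((fun χ : DirichletCharacter ℂ q =>
      ‖DirichletCharacter.LFunction χ (1 / 2)‖) '' (H : Set (DirichletCharacter ℂ q)))
      (maxCentralValue H) := by
  constructor
  · obtain ⟨χ, hχ⟩ := exists_eq_ciSup_of_finite
      (f := fun χ : H => ‖DirichletCharacter.LFunction (χ : DirichletCharacter ℂ q) (1 / 2)‖)
    exact ⟨χ, χ.2, hχ⟩
  · rintro _ ⟨χ, hχ, rfl⟩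
    exact le_ciSup (f := fun χ : H =>
      ‖DirichletCharacter.LFunction (χ : DirichletCharacter ℂ q) (1 / 2)‖)
      (Set.finite_range _).bddAbove ⟨χ, hχ⟩

/-! The proof is Soundararajan's resonance method over a subgroup. For `χ ≠ 1`, Pólya–Vinogradov and
partial summation approximate `L(χ, 1/2)` by a sum of length `X` (`norm_LFunction_half_sub_sum_le`).
Weight this sum by `|R(χ)|²`, where `R` is a resonator of length `N < q` with non-negative
coefficients, and sum over `χ ∈ H`.

From below, orthogonality on `H` makes every term of the expansion have non-negative real part, so
only the solutions of `k * m = n` in integers need be kept. From above, positivity of `|R|²` allows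
extension to all characters, where the mean square is exactly diagonal. The two sides differ by the
index of `H` (`resonance_inequality`), which the hypothesis makes negligible.

The resonator is multiplicative on squarefree products of primes in a set `P`. Markov's inequality
(`le_sum_filter_prod_le`) shows that the cutoff `N` costs only a constant factor, and the gain
becomes an Euler product (`resonance_euler_product`). With `f p = λ / (√p log p)` and `N` near `q ^
(1/2)`, the gain is about `exp √((log q / 2) ∑ 1 / (p log p))`.

Chebyshev's lower bound with constant `log 2` suffices: `√(log 2 / 2) ≈ 0.589` exceeds `1 / √3 ≈
0.577`. This strict surplus pays for all losses, so the error sequence can be taken to be zero. -/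

/-! ### Character sums: Pólya–Vinogradov for prime moduli -/

/-- A geometric sum whose denominator `2 sin(πb/q)` is bounded below by Jordan's inequality at the
nearer of `0` and `q`. Adding both reciprocals avoids a case split when summing over `b`. -/
theorem norm_sum_range_stdAddChar_mul_le {q : ℕ} [NeZero q] {b : ZMod q} (hb : b ≠ 0) (K : ℕ) :
    ‖∑ n ∈ Finset.range K, ZMod.stdAddChar ((n : ZMod q) * b)‖ ≤
      (q : ℝ) / 2 * (1 / (b.val : ℝ) + 1 / ((q : ℝ) - b.val)) := by
  have hq : (0 : ℝ) < q := Nat.cast_pos.2 (NeZero.pos q)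
  have hj0 : (0 : ℝ) < b.val := Nat.cast_pos.2 (ZMod.val_pos.2 hb)
  have hjq : (b.val : ℝ) < q := Nat.cast_lt.2 (ZMod.val_lt b)
  have hpow : ∀ n : ℕ, ZMod.stdAddChar ((n : ZMod q) * b) = ZMod.stdAddChar b ^ n := fun n => by
    rw [← nsmul_eq_mul, AddChar.map_nsmul_eq_pow]
  have hne : ZMod.stdAddChar b ≠ 1 := fun h => hb <| by
    apply ZMod.injective_stdAddChar
    rw [h, AddChar.map_zero_eq_one]
  have hnorm : ‖ZMod.stdAddChar b‖ = 1 := by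
    rw [ZMod.stdAddChar_apply, Circle.norm_coe]
  have hval : ZMod.stdAddChar b =
      Complex.exp (Complex.I * ((2 * Real.pi * b.val / q : ℝ) : ℂ)) := by
    have h := ZMod.stdAddChar_coe (N := q) (b.val : ℤ)
    rw [Int.cast_natCast, ZMod.natCast_zmod_val] at h
    rw [h]
    congr 1
    push_cast
    ring
  have hdist : ‖ZMod.stdAddChar b - 1‖ = 2 * Real.sin (Real.pi * b.val / q) := by
    rw [hval, Complex.norm_exp_I_mul_ofReal_sub_one, Real.norm_eq_abs, abs_of_nonneg]
    · congr 2; ring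
    · have h1 : 2 * Real.pi * b.val / q / 2 = Real.pi * (b.val / q) := by ring
      rw [h1]
      have h2 : (b.val : ℝ) / q ≤ 1 := (div_le_one hq).2 hjq.le
      refine mul_nonneg zero_le_two (Real.sin_nonneg_of_nonneg_of_le_pi (by positivity) ?_)
      nlinarith [Real.pi_pos]
  have hsin : 2 * min (b.val : ℝ) (q - b.val) / q ≤ Real.sin (Real.pi * b.val / q) := by
    rcases le_total (b.val : ℝ) (q - b.val) with h | h
    · rw [min_eq_left h]
      have h1 : Real.pi * b.val / q ≤ Real.pi / 2 := by
        rw [div_le_div_iff₀ hq two_pos]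
        nlinarith [Real.pi_pos]
      refine le_trans (le_of_eq ?_) (Real.mul_le_sin (by positivity) h1)
      field_simp
    · rw [min_eq_right h, ← Real.sin_pi_sub]
      have h1 : Real.pi - Real.pi * b.val / q = Real.pi * (q - b.val) / q := by
        field_simp
      have h2 : Real.pi * (q - b.val) / q ≤ Real.pi / 2 := by
        rw [div_le_div_iff₀ hq two_pos]
        nlinarith [Real.pi_pos]
      have h3 : (0 : ℝ) < q - b.val := by linarith
      rw [h1]
      refine le_trans (le_of_eq ?_) (Real.mul_le_sin (by positivity) h2)
      field_simp
  have hmin : 0 < min (b.val : ℝ) (q - b.val) := lt_min hj0 (by linarith)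
  simp_rw [hpow]
  rw [geom_sum_eq hne, norm_div, hdist]
  have hnum : ‖ZMod.stdAddChar b ^ K - 1‖ ≤ 2 := by
    refine (norm_sub_le _ _).trans ?_
    rw [norm_pow, hnorm]
    norm_num
  calc ‖ZMod.stdAddChar b ^ K - 1‖ / (2 * Real.sin (Real.pi * b.val / q))
      ≤ 2 / (2 * (2 * min (b.val : ℝ) (q - b.val) / q)) := by gcongr
    _ = (q : ℝ) / 2 * (1 / min (b.val : ℝ) (q - b.val)) := by field_simp
    _ ≤ _ := by
      gcongr
      have h3 : (0 : ℝ) < q - b.val := by linarith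
      rcases min_choice (b.val : ℝ) (q - b.val) with h | h <;> rw [h]
      · have : 0 < 1 / ((q : ℝ) - b.val) := by positivity
        linarith
      · have : 0 < 1 / (b.val : ℝ) := by positivity
        linarith

theorem sum_one_div_val_le (q : ℕ) [NeZero q] :
    ∑ b ∈ Finset.univ.erase (0 : ZMod q), (1 / (b.val : ℝ) + 1 / ((q : ℝ) - b.val)) ≤
      2 * (1 + Real.log q) := by
  have h1 : ∑ b ∈ Finset.univ.erase (0 : ZMod q), 1 / (b.val : ℝ) ≤ 1 + Real.log q := by
    calc ∑ b ∈ Finset.univ.erase (0 : ZMod q), 1 / (b.val : ℝ)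
        = ∑ j ∈ (Finset.univ.erase (0 : ZMod q)).image ZMod.val, 1 / (j : ℝ) := by
          rw [Finset.sum_image]
          exact fun a _ b _ h => ZMod.val_injective q h
      _ ≤ ∑ j ∈ Finset.Icc 1 q, 1 / (j : ℝ) := by
          refine Finset.sum_le_sum_of_subset_of_nonneg ?_ fun _ _ _ => by positivity
          intro j hj
          obtain ⟨b, hb, rfl⟩ := Finset.mem_image.1 hj
          exact Finset.mem_Icc.2 ⟨ZMod.val_pos.2 (Finset.ne_of_mem_erase hb), (ZMod.val_lt b).le⟩
      _ ≤ 1 + Real.log q := by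
          have h := harmonic_le_one_add_log q
          rw [harmonic_eq_sum_Icc] at h
          push_cast at h
          simpa using h
  have h2 : ∑ b ∈ Finset.univ.erase (0 : ZMod q), 1 / ((q : ℝ) - b.val) =
      ∑ b ∈ Finset.univ.erase (0 : ZMod q), 1 / (b.val : ℝ) := by
    refine Finset.sum_nbij' (fun b => -b) (fun b => -b) ?_ ?_ ?_ ?_ ?_
    · intro b hb; simpa using hb
    · intro b hb; simpa using hb
    · intro b _; simp
    · intro b _; simp
    · intro b hb
      have hb0 : NeZero b := ⟨Finset.ne_of_mem_erase hb⟩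
      rw [ZMod.val_neg_of_ne_zero, Nat.cast_sub (ZMod.val_lt b).le]
  rw [Finset.sum_add_distrib, h2]
  linarith

theorem norm_gaussSum_of_prime {q : ℕ} [Fact q.Prime] {χ : DirichletCharacter ℂ q} (hχ : χ ≠ 1) :
    ‖gaussSum χ (ZMod.stdAddChar (N := q))‖ = Real.sqrt q := by
  have h := gaussSum_mul_gaussSum_eq_card hχ (ZMod.isPrimitive_stdAddChar q)
  rw [← star_gaussSum_eq, ZMod.card] at h
  have h2 := congrArg norm h
  rw [norm_mul, norm_star, Complex.norm_natCast] at h2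
  rw [← h2, Real.sqrt_mul_self (norm_nonneg _)]

/-- The **Pólya–Vinogradov inequality** for prime moduli. -/
theorem norm_sum_range_dirichletCharacter_le {q : ℕ} [Fact q.Prime] {χ : DirichletCharacter ℂ q}
    (hχ : χ ≠ 1) (K : ℕ) :
    ‖∑ n ∈ Finset.range K, χ (n : ZMod q)‖ ≤ Real.sqrt q * (1 + Real.log q) := by
  have hq : (0 : ℝ) < q := Nat.cast_pos.2 (NeZero.pos q)
  have hχ' : χ⁻¹ ≠ 1 := inv_ne_one.2 hχ
  have hprim : DirichletCharacter.IsPrimitive χ⁻¹ := by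
    rcases (Nat.dvd_prime (Fact.out : q.Prime)).1 χ⁻¹.conductor_dvd_level with h | h
    · exact absurd (DirichletCharacter.eq_one_iff_conductor_eq_one.2 h) hχ'
    · exact h
  set τ := gaussSum χ⁻¹ (ZMod.stdAddChar (N := q)) with hτ
  have hτn : ‖τ‖ = Real.sqrt q := norm_gaussSum_of_prime hχ'
  -- Finite Fourier expansion of `χ`, valid at every `n` because `χ⁻¹` is primitive. The frequency
  -- `b = 0`, where the geometric sum would be large, drops out since `χ⁻¹ 0 = 0`.
  have hkey : (∑ n ∈ Finset.range K, χ (n : ZMod q)) * τ =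
      ∑ b ∈ Finset.univ.erase (0 : ZMod q),
        χ⁻¹ b * ∑ n ∈ Finset.range K, ZMod.stdAddChar ((n : ZMod q) * b) := by
    have h0 : χ⁻¹ (0 : ZMod q) * ∑ n ∈ Finset.range K, ZMod.stdAddChar ((n : ZMod q) * 0) = 0 := by
      rw [MulChar.map_zero, zero_mul]
    rw [Finset.sum_erase (s := Finset.univ) (f := fun b : ZMod q =>
      χ⁻¹ b * ∑ n ∈ Finset.range K, ZMod.stdAddChar ((n : ZMod q) * b)) h0, Finset.sum_mul]
    simp_rw [Finset.mul_sum]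
    rw [Finset.sum_comm]
    refine Finset.sum_congr rfl fun n _ => ?_
    have h := gaussSum_mulShift_of_isPrimitive (ZMod.stdAddChar (N := q)) hprim (n : ZMod q)
    rw [inv_inv] at h
    rw [← h]
    simp [gaussSum, AddChar.mulShift_apply]
  have hb : ‖(∑ n ∈ Finset.range K, χ (n : ZMod q)) * τ‖ ≤ q * (1 + Real.log q) := by
    rw [hkey]
    calc _ ≤ ∑ b ∈ Finset.univ.erase (0 : ZMod q),
          (q : ℝ) / 2 * (1 / (b.val : ℝ) + 1 / ((q : ℝ) - b.val)) := by
          refine norm_sum_le_of_le _ fun b hb => ?_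
          rw [norm_mul]
          refine (mul_le_of_le_one_left (norm_nonneg _) (DirichletCharacter.norm_le_one _ _)).trans ?_
          exact norm_sum_range_stdAddChar_mul_le (Finset.ne_of_mem_erase hb) K
      _ ≤ (q : ℝ) / 2 * (2 * (1 + Real.log q)) := by
          rw [← Finset.mul_sum]
          gcongr
          exact sum_one_div_val_le q
      _ = _ := by ring
  rw [norm_mul, hτn] at hb
  have hs : 0 < Real.sqrt q := Real.sqrt_pos.2 hq
  refine le_of_mul_le_mul_right (hb.trans_eq ?_) hs
  rw [mul_right_comm, Real.mul_self_sqrt hq.le]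

/-! ### Approximating the central value by a partial sum -/

theorem norm_cpow_neg_sub_cpow_neg_succ_le {s : ℂ} (hs : 0 < s.re) (n : ℕ) :
    ‖((n + 1 : ℕ) : ℂ) ^ (-s) - ((n + 2 : ℕ) : ℂ) ^ (-s)‖ ≤
      ‖s‖ * ((n : ℝ) + 1) ^ (-(s.re + 1)) := by
  have hn : (0 : ℝ) < (n : ℝ) + 1 := by positivity
  have hs0 : s ≠ 0 := fun h => by simp [h] at hs
  have hmv := Convex.norm_image_sub_le_of_norm_hasDerivWithin_le (𝕜 := ℝ)
    (f := fun t : ℝ => (t : ℂ) ^ (-s)) (f' := fun t : ℝ => -s * (t : ℂ) ^ (-s - 1))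
    (s := Set.Icc ((n : ℝ) + 1) ((n : ℝ) + 2)) (C := ‖s‖ * ((n : ℝ) + 1) ^ (-(s.re + 1)))
    (x := (n : ℝ) + 2) (y := (n : ℝ) + 1) ?_ ?_ (convex_Icc _ _)
    ⟨by linarith, le_rfl⟩ ⟨le_rfl, by linarith⟩
  · have h1 : ‖(n : ℝ) + 1 - ((n : ℝ) + 2)‖ = 1 := by
      rw [show (n : ℝ) + 1 - ((n : ℝ) + 2) = -1 by ring]; simp
    rw [h1, mul_one] at hmv
    push_cast at hmv ⊢
    exact hmv
  · intro t ht
    have ht0 : t ≠ 0 := by linarith [ht.1]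
    exact (hasDerivAt_ofReal_cpow_const ht0 (neg_ne_zero.2 hs0)).hasDerivWithinAt
  · intro t ht
    have ht0 : 0 < t := by linarith [ht.1]
    rw [norm_mul, norm_neg, Complex.norm_cpow_eq_rpow_re_of_pos ht0]
    gcongr
    rw [show (-s - 1).re = -(s.re + 1) by simp; ring]
    exact Real.rpow_le_rpow_of_nonpos hn ht.1 (by linarith)

/-- Summation by parts for the partial sums of a Dirichlet series. -/
theorem sum_range_mul_cpow_neg_eq (c : ℕ → ℂ) (hc : c 0 = 0) (s : ℂ) (X : ℕ) :
    ∑ k ∈ Finset.range X, c (k + 1) * ((k + 1 : ℕ) : ℂ) ^ (-s) =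
      ∑ n ∈ Finset.range X, (∑ k ∈ Finset.range (n + 2), c k) *
        (((n + 1 : ℕ) : ℂ) ^ (-s) - ((n + 2 : ℕ) : ℂ) ^ (-s)) +
      (∑ k ∈ Finset.range (X + 1), c k) * ((X + 1 : ℕ) : ℂ) ^ (-s) := by
  induction X with
  | zero => simp [hc]
  | succ X ih =>
    rw [Finset.sum_range_succ, ih, Finset.sum_range_succ (fun n => (∑ k ∈ Finset.range (n + 2), c k) *
      (((n + 1 : ℕ) : ℂ) ^ (-s) - ((n + 2 : ℕ) : ℂ) ^ (-s))) X,
      show X + 1 + 1 = X + 2 from rfl, Finset.sum_range_succ c (X + 1)]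
    ring

section BoundedPartialSums

variable {c : ℕ → ℂ} {B : ℝ}

/-- A majorant uniform in `s`, needed for analyticity of the series; the exponent is `5/4 = 1/4 +
1`. -/
theorem norm_partialSum_term_le (hB : ∀ n, ‖∑ k ∈ Finset.range n, c k‖ ≤ B) {s : ℂ}
    (hs : 1 / 4 < s.re) (hs4 : ‖s‖ < 4) (n : ℕ) :
    ‖(∑ k ∈ Finset.range (n + 2), c k) *
        (((n + 1 : ℕ) : ℂ) ^ (-s) - ((n + 2 : ℕ) : ℂ) ^ (-s))‖ ≤
      B * (4 * ((n : ℝ) + 1) ^ (-(5 / 4 : ℝ))) := by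
  have hB0 : 0 ≤ B := (norm_nonneg _).trans (hB 0)
  rw [norm_mul]
  refine mul_le_mul (hB _) ((norm_cpow_neg_sub_cpow_neg_succ_le (by linarith) n).trans ?_)
    (norm_nonneg _) hB0
  gcongr
  · linarith [Nat.cast_nonneg (α := ℝ) n]
  · linarith

theorem summable_partialSum_bound (B : ℝ) :
    Summable fun n : ℕ => B * (4 * ((n : ℝ) + 1) ^ (-(5 / 4 : ℝ))) := by
  refine (Summable.mul_left _ ?_).mul_left _
  have h := (summable_nat_add_iff 1).2 (Real.summable_nat_rpow (p := -(5 / 4 : ℝ)).2 (by norm_num))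
  simpa using h

theorem tendsto_partialSum_mul_cpow_neg (hB : ∀ n, ‖∑ k ∈ Finset.range n, c k‖ ≤ B) {s : ℂ}
    (hs : 0 < s.re) :
    Tendsto (fun X : ℕ => (∑ k ∈ Finset.range (X + 1), c k) * ((X + 1 : ℕ) : ℂ) ^ (-s))
      atTop (𝓝 0) := by
  have hB0 : 0 ≤ B := (norm_nonneg _).trans (hB 0)
  have h1 : Tendsto (fun X : ℕ => B * (((X + 1 : ℕ) : ℝ)) ^ (-s.re)) atTop (𝓝 0) := by
    have := ((tendsto_rpow_neg_atTop hs).comp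
      (tendsto_natCast_atTop_atTop.comp (tendsto_add_atTop_nat 1))).const_mul B
    simpa using this
  refine squeeze_zero_norm (fun X => ?_) h1
  rw [norm_mul, Complex.norm_natCast_cpow_of_pos (Nat.succ_pos X), Complex.neg_re]
  gcongr
  exact hB _

theorem tendsto_sum_range_mul_cpow_neg (hc : c 0 = 0)
    (hB : ∀ n, ‖∑ k ∈ Finset.range n, c k‖ ≤ B) {s : ℂ}
    (hs : 1 / 4 < s.re) (hs4 : ‖s‖ < 4) :
    Tendsto (fun X : ℕ => ∑ k ∈ Finset.range X, c (k + 1) * ((k + 1 : ℕ) : ℂ) ^ (-s)) atTop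
      (𝓝 (∑' n : ℕ, (∑ k ∈ Finset.range (n + 2), c k) *
        (((n + 1 : ℕ) : ℂ) ^ (-s) - ((n + 2 : ℕ) : ℂ) ^ (-s)))) := by
  simp_rw [sum_range_mul_cpow_neg_eq c hc s]
  have hsum := Summable.of_norm_bounded (summable_partialSum_bound B)
    (norm_partialSum_term_le hB hs hs4)
  simpa using hsum.hasSum.tendsto_sum_nat.add (tendsto_partialSum_mul_cpow_neg hB (by linarith))

end BoundedPartialSums

/-- If the character sums are bounded, then the Dirichlet series of `χ` converges to the analytic
continuation of its `L`-function at `1 / 2`. -/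
theorem tendsto_sum_range_LFunction_half {q : ℕ} [NeZero q] {χ : DirichletCharacter ℂ q}
    (hχ : χ ≠ 1) {B : ℝ} (hB : ∀ n, ‖∑ k ∈ Finset.range n, χ (k : ZMod q)‖ ≤ B) :
    Tendsto (fun X : ℕ => ∑ k ∈ Finset.range X,
      χ ((k + 1 : ℕ) : ZMod q) * ((k + 1 : ℕ) : ℂ) ^ (-(1 / 2 : ℂ))) atTop
      (𝓝 (DirichletCharacter.LFunction χ (1 / 2))) := by
  have hc : (fun k : ℕ => χ (k : ZMod q)) 0 = 0 := by
    have hq1 : q ≠ 1 := by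
      rintro rfl
      exact hχ (DirichletCharacter.level_one χ)
    have : Fact (1 < q) := ⟨lt_of_le_of_ne (NeZero.pos q) (Ne.symm hq1)⟩
    simp [MulChar.map_zero]
  -- A convex region containing both `2`, where the Dirichlet series converges absolutely, and
  -- `1/2`; the identity theorem carries the equality from one to the other.
  set U : Set ℂ := {s | 1 / 4 < s.re} ∩ Metric.ball 0 4 with hU
  have hUo : IsOpen U := (isOpen_lt continuous_const Complex.continuous_re).inter Metric.isOpen_ball
  have hUc : Convex ℝ U := (convex_halfSpace_re_gt _).inter (convex_ball _ _)
  set G : ℂ → ℂ := fun s => ∑' n : ℕ, (∑ k ∈ Finset.range (n + 2), χ (k : ZMod q)) *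
        (((n + 1 : ℕ) : ℂ) ^ (-s) - ((n + 2 : ℕ) : ℂ) ^ (-s)) with hG
  have hmem : ∀ {s}, s ∈ U → 1 / 4 < s.re ∧ ‖s‖ < 4 := fun h => ⟨h.1, by simpa using h.2⟩
  have hGd : DifferentiableOn ℂ G U := by
    refine Complex.differentiableOn_tsum_of_summable_norm (summable_partialSum_bound B)
      (fun n => ?_) hUo fun n s hs => norm_partialSum_term_le hB (hmem hs).1 (hmem hs).2 n
    have h1 : ((n + 1 : ℕ) : ℂ) ≠ 0 := Nat.cast_ne_zero.2 (by omega)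
    have h2 : ((n + 2 : ℕ) : ℂ) ≠ 0 := Nat.cast_ne_zero.2 (by omega)
    refine Differentiable.differentiableOn ?_
    exact (((differentiable_id.neg).const_cpow (Or.inl h1)).sub
      ((differentiable_id.neg).const_cpow (Or.inl h2))).const_mul _
  have hlim : ∀ s ∈ U, Tendsto (fun X : ℕ => ∑ k ∈ Finset.range X,
      χ ((k + 1 : ℕ) : ZMod q) * ((k + 1 : ℕ) : ℂ) ^ (-s)) atTop (𝓝 (G s)) := fun s hs =>
    tendsto_sum_range_mul_cpow_neg (c := fun k : ℕ => χ (k : ZMod q)) hc hB (hmem hs).1 (hmem hs).2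
  have hLser : ∀ s ∈ U, 1 < s.re → DirichletCharacter.LFunction χ s = G s := by
    intro s hs h1
    rw [DirichletCharacter.LFunction_eq_LSeries χ h1]
    have hsm := (DirichletCharacter.LSeriesSummable_of_one_lt_re χ h1).hasSum.tendsto_sum_nat
    have h2 := hsm.comp (tendsto_add_atTop_nat 1)
    refine tendsto_nhds_unique h2 ((hlim s hs).congr fun X => ?_)
    rw [Function.comp_apply, Finset.sum_range_succ']
    simp only [LSeries.term_zero, add_zero]
    refine Finset.sum_congr rfl fun k _ => ?_
    rw [LSeries.term_of_ne_zero (by omega), Complex.cpow_neg, div_eq_mul_inv]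
  have h2U : (2 : ℂ) ∈ U := ⟨by norm_num, by simp; norm_num⟩
  have hhalf : (1 / 2 : ℂ) ∈ U := ⟨by norm_num, by simp; norm_num⟩
  have heq := AnalyticOnNhd.eqOn_of_preconnected_of_eventuallyEq
    ((DirichletCharacter.differentiable_LFunction hχ).differentiableOn.analyticOnNhd hUo)
    (hGd.analyticOnNhd hUo) hUc.isPreconnected h2U (by
      filter_upwards [hUo.mem_nhds h2U,
        (isOpen_lt continuous_const Complex.continuous_re).mem_nhds
          (show (1 : ℝ) < (2 : ℂ).re by norm_num)] with s hs h1
      exact hLser s hs h1) hhalf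
  rw [heq]
  exact hlim _ hhalf

/-- Partial summation on the tail from `X` to `Y`: the decreasing weights telescope, and with the
two boundary terms the bound no longer depends on `Y`, so `Y → ∞` is harmless. -/
theorem norm_LFunction_half_sub_sum_le {q : ℕ} [NeZero q] {χ : DirichletCharacter ℂ q}
    (hχ : χ ≠ 1) {B : ℝ} (hB : ∀ n, ‖∑ k ∈ Finset.range n, χ (k : ZMod q)‖ ≤ B) (X : ℕ) :
    ‖DirichletCharacter.LFunction χ (1 / 2) - ∑ k ∈ Finset.range X,
      χ ((k + 1 : ℕ) : ZMod q) * (((Real.sqrt (k + 1 : ℕ))⁻¹ : ℝ) : ℂ)‖ ≤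
      2 * B / Real.sqrt (X + 1 : ℕ) := by
  have hB0 : 0 ≤ B := (norm_nonneg _).trans (hB 0)
  have hpow : ∀ n : ℕ, (n : ℂ) ^ (-(1 / 2 : ℂ)) = (((Real.sqrt n)⁻¹ : ℝ) : ℂ) := fun n => by
    rw [Real.sqrt_eq_rpow, ← Real.rpow_neg (Nat.cast_nonneg n), Complex.ofReal_cpow (Nat.cast_nonneg n)]
    push_cast
    norm_num
  have hc : (fun k : ℕ => χ (k : ZMod q)) 0 = 0 := by
    have hq1 : q ≠ 1 := by
      rintro rfl
      exact hχ (DirichletCharacter.level_one χ)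
    have : Fact (1 < q) := ⟨lt_of_le_of_ne (NeZero.pos q) (Ne.symm hq1)⟩
    simp [MulChar.map_zero]
  have hlim := tendsto_sum_range_LFunction_half hχ hB
  have habel := sum_range_mul_cpow_neg_eq (fun k : ℕ => χ (k : ZMod q)) hc (1 / 2)
  simp only [hpow] at hlim habel
  refine le_of_tendsto (hlim.sub_const _).norm ?_
  filter_upwards [eventually_ge_atTop X] with Y hY
  rw [habel Y, habel X]
  set d : ℕ → ℝ := fun n => (Real.sqrt (n : ℕ))⁻¹ with hd
  have hdanti : ∀ n : ℕ, d (n + 2) ≤ d (n + 1) := fun n => by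
    simp only [hd]
    gcongr
    omega
  have hd0 : ∀ n, 0 ≤ d n := fun n => by simp only [hd]; positivity
  have htel : ∀ Y, X ≤ Y → ‖∑ n ∈ Finset.Ico X Y,
      (∑ k ∈ Finset.range (n + 2), χ (k : ZMod q)) * ((d (n + 1) : ℂ) - (d (n + 2) : ℂ))‖ ≤
      B * (d (X + 1) - d (Y + 1)) := by
    intro Y hY
    induction Y, hY using Nat.le_induction with
    | base => simp
    | succ Y hY ih =>
      rw [Finset.sum_Ico_succ_top hY]
      refine (norm_add_le _ _).trans ?_
      have h1 : ‖(∑ k ∈ Finset.range (Y + 2), χ (k : ZMod q)) *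
          ((d (Y + 1) : ℂ) - (d (Y + 2) : ℂ))‖ ≤ B * (d (Y + 1) - d (Y + 2)) := by
        rw [norm_mul, ← Complex.ofReal_sub, Complex.norm_real, Real.norm_eq_abs,
          abs_of_nonneg (sub_nonneg.2 (hdanti Y))]
        exact mul_le_mul_of_nonneg_right (hB _) (sub_nonneg.2 (hdanti Y))
      linarith
  have hend : ∀ Z : ℕ, ‖(∑ k ∈ Finset.range (Z + 1), χ (k : ZMod q)) * (d (Z + 1) : ℂ)‖ ≤
      B * d (Z + 1) := fun Z => by
    rw [norm_mul, Complex.norm_real, Real.norm_eq_abs, abs_of_nonneg (hd0 _)]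
    exact mul_le_mul_of_nonneg_right (hB _) (hd0 _)
  rw [add_sub_add_comm, ← Finset.sum_Ico_eq_sub _ hY]
  refine (norm_add_le _ _).trans ?_
  have h1 := htel Y hY
  have h2 := norm_sub_le ((∑ k ∈ Finset.range (Y + 1), χ (k : ZMod q)) * (d (Y + 1) : ℂ))
    ((∑ k ∈ Finset.range (X + 1), χ (k : ZMod q)) * (d (X + 1) : ℂ))
  have h3 := hend Y
  have h4 := hend X
  have h5 : 2 * B / Real.sqrt (X + 1 : ℕ) = 2 * B * d (X + 1) := by
    simp only [hd]; rw [div_eq_mul_inv]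
  rw [h5]
  linarith

/-! ### Resonator means over a subgroup of characters -/

/-- Either all terms are `1`, or translating by some `χ₀ ∈ H` with `χ₀ u ≠ 1` forces the sum to
vanish. This lets off-diagonal terms be discarded for any `H`. -/
theorem re_sum_subgroup_apply_nonneg {q : ℕ} [NeZero q] (H : Subgroup (DirichletCharacter ℂ q))
    [DecidablePred (· ∈ H)] (u : ZMod q) :
    0 ≤ (∑ χ : DirichletCharacter ℂ q with χ ∈ H, χ u).re := by
  by_cases h : ∀ χ ∈ H, χ u = 1
  · rw [Finset.sum_congr rfl fun χ hχ => h χ (Finset.mem_filter.1 hχ).2]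
    simp
  · push Not at h
    obtain ⟨χ₀, hχ₀, hne⟩ := h
    have h0 : ∑ χ : DirichletCharacter ℂ q with χ ∈ H, χ u = 0 := by
      refine eq_zero_of_mul_eq_self_left hne ?_
      rw [Finset.mul_sum]
      refine Finset.sum_nbij' (fun χ => χ₀ * χ) (fun χ => χ₀⁻¹ * χ) ?_ ?_ ?_ ?_ ?_
      · intro χ hχ
        simpa using H.mul_mem hχ₀ (Finset.mem_filter.1 hχ).2
      · intro χ hχ
        simpa using H.mul_mem (H.inv_mem hχ₀) (Finset.mem_filter.1 hχ).2
      · intro χ _; simp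
      · intro χ _; simp
      · intro χ _; simp
    rw [h0, Complex.zero_re]

theorem sum_range_inv_sqrt_succ_le (X : ℕ) :
    ∑ k ∈ Finset.range X, (Real.sqrt (k + 1 : ℕ))⁻¹ ≤ 2 * Real.sqrt X := by
  induction X with
  | zero => simp
  | succ X ih =>
    rw [Finset.sum_range_succ]
    have h1 : 0 < Real.sqrt (X + 1 : ℕ) := Real.sqrt_pos.2 (Nat.cast_pos.2 X.succ_pos)
    have h2 : Real.sqrt X ≤ Real.sqrt (X + 1 : ℕ) :=
      Real.sqrt_le_sqrt (Nat.cast_le.2 X.le_succ)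
    have h3 : Real.sqrt (X + 1 : ℕ) ^ 2 - Real.sqrt X ^ 2 = 1 := by
      rw [Real.sq_sqrt (Nat.cast_nonneg _), Real.sq_sqrt (Nat.cast_nonneg _)]
      push_cast; ring
    have h4 : (Real.sqrt (X + 1 : ℕ))⁻¹ ≤ 2 * (Real.sqrt (X + 1 : ℕ) - Real.sqrt X) := by
      rw [inv_le_iff_one_le_mul₀ h1]
      nlinarith
    linarith

section Resonator

variable {q : ℕ} [Fact q.Prime] {α : Type*} {𝒟 : Finset α} {ν : α → ℕ} {N : ℕ}

theorem star_dirichletCharacter_apply (χ : DirichletCharacter ℂ q) (a : ZMod q) :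
    star (χ a) = χ a⁻¹ := by
  rw [MulChar.star_apply', MulChar.inv_apply']

theorem natCast_zmod_ne_zero {n : ℕ} (h0 : 0 < n) (hn : n < q) : (n : ZMod q) ≠ 0 := by
  intro h
  exact absurd (Nat.le_of_dvd h0 ((ZMod.natCast_eq_zero_iff _ _).1 h)) (not_le.2 hn)

/-- Distinct integers in `(0, q)` are distinct residues, so orthogonality leaves exactly the
diagonal. -/
theorem sum_norm_sq_resonator (hinj : Set.InjOn ν 𝒟) (hpos : ∀ S ∈ 𝒟, 0 < ν S)
    (hlt : ∀ S ∈ 𝒟, ν S < q) (r : α → ℝ) :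
    ∑ χ : DirichletCharacter ℂ q, ‖∑ S ∈ 𝒟, (r S : ℂ) * χ (ν S : ZMod q)‖ ^ 2 =
      ((q : ℝ) - 1) * ∑ S ∈ 𝒟, r S ^ 2 := by
  classical
  have hC : ((∑ χ : DirichletCharacter ℂ q,
      ‖∑ S ∈ 𝒟, (r S : ℂ) * χ (ν S : ZMod q)‖ ^ 2 : ℝ) : ℂ) =
      (((q : ℝ) - 1) * ∑ S ∈ 𝒟, r S ^ 2 : ℝ) := by
    push_cast
    calc _ = ∑ χ : DirichletCharacter ℂ q, ∑ T ∈ 𝒟, ∑ S ∈ 𝒟,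
          (r T * r S : ℂ) * (χ (ν T : ZMod q)⁻¹ * χ (ν S : ZMod q)) := by
          refine Finset.sum_congr rfl fun χ _ => ?_
          rw [← Complex.conj_mul', starRingEnd_apply, star_sum,
            Finset.sum_mul_sum]
          refine Finset.sum_congr rfl fun T _ => Finset.sum_congr rfl fun S _ => ?_
          rw [star_mul', star_dirichletCharacter_apply]
          simp only [Complex.star_def, Complex.conj_ofReal]
          ring
      _ = ∑ T ∈ 𝒟, ∑ S ∈ 𝒟, (r T * r S : ℂ) *
          ∑ χ : DirichletCharacter ℂ q, (χ (ν T : ZMod q)⁻¹ * χ (ν S : ZMod q)) := by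
          rw [Finset.sum_comm]
          refine Finset.sum_congr rfl fun T _ => ?_
          rw [Finset.sum_comm]
          simp_rw [Finset.mul_sum]
      _ = ∑ T ∈ 𝒟, ∑ S ∈ 𝒟, if S = T then ((q : ℂ) - 1) * (r S : ℂ) ^ 2 else 0 := by
          refine Finset.sum_congr rfl fun T hT => Finset.sum_congr rfl fun S hS => ?_
          rw [DirichletCharacter.sum_char_inv_mul_char_eq ℂ
            (natCast_zmod_ne_zero (hpos T hT) (hlt T hT)).isUnit]
          by_cases h : S = T
          · subst h
            rw [if_pos rfl, if_pos rfl, Nat.totient_prime Fact.out,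
              Nat.cast_sub (Fact.out : q.Prime).one_le]
            push_cast; ring
          · rw [if_neg h, if_neg, mul_zero]
            intro he
            have := (ZMod.natCast_eq_natCast_iff' _ _ _).1 he
            rw [Nat.mod_eq_of_lt (hlt T hT), Nat.mod_eq_of_lt (hlt S hS)] at this
            exact h (hinj hS hT this.symm)
      _ = _ := by
          rw [Finset.mul_sum]
          refine Finset.sum_congr rfl fun T hT => ?_
          rw [Finset.sum_ite_eq' 𝒟 T, if_pos hT]
  exact_mod_cast hC

/-- Cauchy–Schwarz with at most `N` terms; used for the principal character. -/
theorem norm_sq_resonator_one_le (hinj : Set.InjOn ν 𝒟) (hpos : ∀ S ∈ 𝒟, 0 < ν S)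
    (hN : ∀ S ∈ 𝒟, ν S ≤ N) (χ : DirichletCharacter ℂ q) {r : α → ℝ} (hr : ∀ S, 0 ≤ r S) :
    ‖∑ S ∈ 𝒟, (r S : ℂ) * χ (ν S : ZMod q)‖ ^ 2 ≤ N * ∑ S ∈ 𝒟, r S ^ 2 := by
  have h1 : ‖∑ S ∈ 𝒟, (r S : ℂ) * χ (ν S : ZMod q)‖ ≤ ∑ S ∈ 𝒟, r S := by
    refine norm_sum_le_of_le _ fun S _ => ?_
    rw [norm_mul, Complex.norm_real, Real.norm_eq_abs, abs_of_nonneg (hr S)]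
    exact mul_le_of_le_one_right (hr S) (DirichletCharacter.norm_le_one _ _)
  have hcard : 𝒟.card ≤ N := by
    rw [← Finset.card_image_of_injOn hinj, ← Nat.add_sub_cancel N 1, ← Nat.card_Icc 1 N]
    refine Finset.card_le_card fun n hn => ?_
    obtain ⟨S, hS, rfl⟩ := Finset.mem_image.1 hn
    exact Finset.mem_Icc.2 ⟨hpos S hS, hN S hS⟩
  calc _ ≤ (∑ S ∈ 𝒟, r S) ^ 2 := by gcongr
    _ ≤ 𝒟.card * ∑ S ∈ 𝒟, r S ^ 2 := sq_sum_le_card_mul_sum_sq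
    _ ≤ _ := by
      gcongr

/-- The resonance inequality: the mean of the central values over a subgroup of characters,
weighted by the square of a resonator of length `N` with non-negative coefficients. -/
theorem resonance_inequality (H : Subgroup (DirichletCharacter ℂ q))
    (hinj : Set.InjOn ν 𝒟) (hpos : ∀ S ∈ 𝒟, 0 < ν S)
    (hN : ∀ S ∈ 𝒟, ν S ≤ N) (hNq : N < q) {r : α → ℝ} (hr : ∀ S, 0 ≤ r S) (X : ℕ) {E V : ℝ}
    (hE0 : 0 ≤ E)
    (hE : ∀ χ : DirichletCharacter ℂ q, χ ≠ 1 → ‖DirichletCharacter.LFunction χ (1 / 2) -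
      ∑ k ∈ Finset.range X,
        χ ((k + 1 : ℕ) : ZMod q) * (((Real.sqrt (k + 1 : ℕ))⁻¹ : ℝ) : ℂ)‖ ≤ E)
    (hV : ∀ χ ∈ H, ‖DirichletCharacter.LFunction χ (1 / 2)‖ ≤ V) :
    (Nat.card H : ℝ) * ∑ T ∈ 𝒟, ∑ S ∈ 𝒟, ∑ k ∈ Finset.range X,
      (if (k + 1) * ν S = ν T then r T * r S * (Real.sqrt (k + 1 : ℕ))⁻¹ else 0) ≤
      ((V + E) * ((q : ℝ) - 1) + 2 * Real.sqrt X * N) * ∑ S ∈ 𝒟, r S ^ 2 := by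
  classical
  set d : ℕ → ℝ := fun k => (Real.sqrt (k + 1 : ℕ))⁻¹ with hd
  have hd0 : ∀ k, 0 ≤ d k := fun k => by simp only [hd]; positivity
  set P : DirichletCharacter ℂ q → ℂ := fun χ =>
    ∑ k ∈ Finset.range X, χ ((k + 1 : ℕ) : ZMod q) * (d k : ℂ) with hP
  set R : DirichletCharacter ℂ q → ℂ := fun χ => ∑ S ∈ 𝒟, (r S : ℂ) * χ (ν S : ZMod q) with hR
  have hV0 : 0 ≤ V := (norm_nonneg _).trans (hV 1 H.one_mem)
  have hq1 : (1 : ℝ) ≤ q := Nat.one_le_cast.2 (Fact.out : q.Prime).one_le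
  have hexpand : ∑ χ : DirichletCharacter ℂ q with χ ∈ H, P χ * (‖R χ‖ ^ 2 : ℝ) =
      ∑ T ∈ 𝒟, ∑ S ∈ 𝒟, ∑ k ∈ Finset.range X, ((r T * r S * d k : ℝ) : ℂ) *
        ∑ χ : DirichletCharacter ℂ q with χ ∈ H,
          χ (((k + 1 : ℕ) : ZMod q) * (ν S : ZMod q) * (ν T : ZMod q)⁻¹) := by
    simp_rw [Finset.mul_sum]
    rw [Finset.sum_congr rfl fun T _ => Finset.sum_congr rfl fun S _ => Finset.sum_comm,
      Finset.sum_congr rfl fun T _ => Finset.sum_comm, Finset.sum_comm]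
    refine Finset.sum_congr rfl fun χ _ => ?_
    rw [Complex.ofReal_pow, ← Complex.conj_mul', starRingEnd_apply, hR, star_sum, Finset.sum_mul_sum, Finset.mul_sum]
    refine Finset.sum_congr rfl fun T _ => ?_
    rw [Finset.mul_sum]
    refine Finset.sum_congr rfl fun S _ => ?_
    rw [hP, Finset.sum_mul]
    refine Finset.sum_congr rfl fun k _ => ?_
    rw [star_mul', star_dirichletCharacter_apply, map_mul, map_mul]
    simp only [Complex.star_def, Complex.conj_ofReal]
    push_cast
    ring
  have hlower : (Nat.card H : ℝ) * ∑ T ∈ 𝒟, ∑ S ∈ 𝒟, ∑ k ∈ Finset.range X,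
      (if (k + 1) * ν S = ν T then r T * r S * d k else 0) ≤
      (∑ χ : DirichletCharacter ℂ q with χ ∈ H, P χ * (‖R χ‖ ^ 2 : ℝ)).re := by
    rw [hexpand]
    simp_rw [Complex.re_sum, Finset.mul_sum]
    refine Finset.sum_le_sum fun T hT => Finset.sum_le_sum fun S hS => Finset.sum_le_sum
      fun k _ => ?_
    rw [← Finset.mul_sum, Complex.re_ofReal_mul]
    have h0 : 0 ≤ r T * r S * d k := mul_nonneg (mul_nonneg (hr T) (hr S)) (hd0 k)
    split_ifs with h
    · have hu : ((k + 1 : ℕ) : ZMod q) * (ν S : ZMod q) * (ν T : ZMod q)⁻¹ = 1 := by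
        rw [← Nat.cast_mul, h]
        exact mul_inv_cancel₀ (natCast_zmod_ne_zero (hpos T hT) ((hN T hT).trans_lt hNq))
      have hc : Finset.card {χ : DirichletCharacter ℂ q | χ ∈ H} = Nat.card H := by
        rw [← Fintype.card_subtype, ← Nat.card_eq_fintype_card]
      rw [hu]
      simp only [map_one, Finset.sum_const, nsmul_eq_mul, mul_one, Complex.natCast_re, hc]
      rw [mul_comm]
    · rw [mul_zero]
      exact mul_nonneg h0 (re_sum_subgroup_apply_nonneg H _)
  -- The principal character, to which `hE` does not apply, is bounded trivially. Afterwards all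
  -- summands are non-negative and the range may be enlarged from `H` to the full group.
  have hupper : (∑ χ : DirichletCharacter ℂ q with χ ∈ H, P χ * (‖R χ‖ ^ 2 : ℝ)).re ≤
      ∑ χ : DirichletCharacter ℂ q, ((V + E) * ‖R χ‖ ^ 2 +
        if χ = 1 then 2 * Real.sqrt X * (N * ∑ S ∈ 𝒟, r S ^ 2) else 0) := by
    refine (Complex.re_le_norm _).trans ((norm_sum_le _ _).trans ?_)
    refine (Finset.sum_le_sum fun χ hχ => ?_).trans
      (Finset.sum_le_sum_of_subset_of_nonneg (Finset.filter_subset _ _) fun χ _ _ => ?_)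
    · rw [norm_mul, Complex.norm_real, Real.norm_eq_abs, abs_of_nonneg (sq_nonneg ‖R χ‖)]
      by_cases h : χ = 1
      · rw [if_pos h]
        have h1 : ‖P χ‖ ≤ 2 * Real.sqrt X := by
          refine le_trans (norm_sum_le_of_le _ fun k _ => ?_) (sum_range_inv_sqrt_succ_le X)
          rw [norm_mul, Complex.norm_real, Real.norm_eq_abs, abs_of_nonneg (hd0 k)]
          exact mul_le_of_le_one_left (hd0 k) (DirichletCharacter.norm_le_one _ _)
        have h2 := norm_sq_resonator_one_le hinj hpos hN χ hr
        have h3 : ‖P χ‖ * ‖R χ‖ ^ 2 ≤ 2 * Real.sqrt X * (N * ∑ S ∈ 𝒟, r S ^ 2) :=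
          mul_le_mul h1 h2 (sq_nonneg _) (by positivity)
        have h4 : 0 ≤ (V + E) * ‖R χ‖ ^ 2 := by positivity
        linarith
      · rw [if_neg h, add_zero]
        gcongr
        have h1 := hV χ (Finset.mem_filter.1 hχ).2
        have h2 := norm_le_norm_add_norm_sub (DirichletCharacter.LFunction χ (1 / 2)) (P χ)
        linarith [hE χ h]
    · have : 0 ≤ ∑ S ∈ 𝒟, r S ^ 2 := Finset.sum_nonneg fun _ _ => sq_nonneg _
      split_ifs <;> positivity
  refine hlower.trans (hupper.trans_eq ?_)
  rw [Finset.sum_add_distrib, ← Finset.mul_sum,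
    sum_norm_sq_resonator hinj hpos (fun S hS => (hN S hS).trans_lt hNq) r, Finset.sum_ite_eq',
    if_pos (Finset.mem_univ _)]
  ring

end Resonator

/-! ### Euler product resonators -/

/-- An expectation bound: under the normalised weights each `p` is included independently with
probability `w p / (1 + w p) ≤ w p`. -/
theorem sum_powerset_prod_mul_sum_le {ι : Type*} [DecidableEq ι] (P : Finset ι) {w g : ι → ℝ}
    (hw : ∀ p ∈ P, 0 ≤ w p) (hg : ∀ p ∈ P, 0 ≤ g p) :
    ∑ T ∈ P.powerset, (∏ p ∈ T, w p) * ∑ p ∈ T, g p ≤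
      (∑ p ∈ P, w p * g p) * ∏ p ∈ P, (1 + w p) := by
  induction P using Finset.induction_on with
  | empty => simp
  | insert a P ha ih =>
    have ih := ih (fun p hp => hw p (Finset.mem_insert_of_mem hp))
      fun p hp => hg p (Finset.mem_insert_of_mem hp)
    have hwa := hw a (Finset.mem_insert_self a P)
    have hga := hg a (Finset.mem_insert_self a P)
    have hprod : ∑ T ∈ P.powerset, ∏ p ∈ T, w p = ∏ p ∈ P, (1 + w p) :=
      (Finset.prod_one_add P).symm
    have hprod0 : 0 ≤ ∏ p ∈ P, (1 + w p) :=
      Finset.prod_nonneg fun p hp => by linarith [hw p (Finset.mem_insert_of_mem hp)]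
    rw [Finset.sum_powerset_insert ha, Finset.sum_insert ha, Finset.prod_insert ha]
    have h1 : ∑ T ∈ P.powerset, (∏ p ∈ insert a T, w p) * ∑ p ∈ insert a T, g p =
        w a * g a * ∏ p ∈ P, (1 + w p) +
          w a * ∑ T ∈ P.powerset, (∏ p ∈ T, w p) * ∑ p ∈ T, g p := by
      rw [← hprod, Finset.mul_sum, Finset.mul_sum, ← Finset.sum_add_distrib]
      refine Finset.sum_congr rfl fun T hT => ?_
      have haT : a ∉ T := fun h => ha (Finset.mem_powerset.1 hT h)
      rw [Finset.prod_insert haT, Finset.sum_insert haT]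
      ring
    rw [h1]
    nlinarith [mul_nonneg (mul_nonneg hwa hga) (mul_nonneg hwa hprod0),
      mul_le_mul_of_nonneg_left ih hwa]

theorem log_prod_id {T : Finset ℕ} (hT : ∀ p ∈ T, p.Prime) :
    Real.log ((∏ p ∈ T, p : ℕ) : ℝ) = ∑ p ∈ T, Real.log p := by
  rw [Nat.cast_prod, Real.log_prod fun p hp => Nat.cast_ne_zero.2 (hT p hp).ne_zero]

/-- If the logarithm of a random squarefree product of primes has mean at most `(1 - ε) log N`,
then the product is at most `N` with probability at least `ε`. -/
theorem le_sum_filter_prod_le {P : Finset ℕ} (hP : ∀ p ∈ P, p.Prime) {w : ℕ → ℝ}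
    (hw : ∀ p ∈ P, 0 ≤ w p) {N : ℕ} (hN : 2 ≤ N) {ε : ℝ}
    (hsum : ∑ p ∈ P, w p * Real.log p ≤ (1 - ε) * Real.log N) :
    ε * ∏ p ∈ P, (1 + w p) ≤ ∑ T ∈ P.powerset with ∏ p ∈ T, p ≤ N, ∏ p ∈ T, w p := by
  have hlogN : 0 < Real.log N := Real.log_pos (by exact_mod_cast hN)
  have hT0 : ∀ T ∈ P.powerset, 0 ≤ ∏ p ∈ T, w p := fun T hT =>
    Finset.prod_nonneg fun p hp => hw p (Finset.mem_powerset.1 hT hp)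
  have hg : ∀ p ∈ P, 0 ≤ Real.log p := fun p _ => Real.log_natCast_nonneg p
  have hprod0 : 0 ≤ ∏ p ∈ P, (1 + w p) := Finset.prod_nonneg fun p hp => by linarith [hw p hp]
  have hmean := sum_powerset_prod_mul_sum_le P hw hg
  have hsplit := Finset.sum_filter_add_sum_filter_not P.powerset (fun T => ∏ p ∈ T, p ≤ N)
    (fun T => ∏ p ∈ T, w p)
  rw [← Finset.prod_one_add P] at hsplit
  -- Markov's inequality for the logarithm of the product.
  have hlarge : Real.log N * ∑ T ∈ P.powerset with ¬ ∏ p ∈ T, p ≤ N, ∏ p ∈ T, w p ≤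
      ∑ T ∈ P.powerset, (∏ p ∈ T, w p) * ∑ p ∈ T, Real.log p := by
    rw [Finset.mul_sum]
    refine (Finset.sum_le_sum fun T hT => ?_).trans (Finset.sum_le_sum_of_subset_of_nonneg
      (Finset.filter_subset _ _) fun T hT _ => mul_nonneg (hT0 T hT) (Finset.sum_nonneg
        fun p hp => hg p (Finset.mem_powerset.1 hT hp)))
    obtain ⟨hT1, hT2⟩ := Finset.mem_filter.1 hT
    rw [mul_comm, ← log_prod_id fun p hp => hP p (Finset.mem_powerset.1 hT1 hp)]
    refine mul_le_mul_of_nonneg_left (Real.log_le_log (by positivity) ?_) (hT0 T hT1)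
    exact_mod_cast (not_le.1 hT2).le
  have h1 : Real.log N * ∑ T ∈ P.powerset with ¬ ∏ p ∈ T, p ≤ N, ∏ p ∈ T, w p ≤
      Real.log N * ((1 - ε) * ∏ p ∈ P, (1 + w p)) := by
    refine hlarge.trans (hmean.trans ?_)
    nlinarith [mul_le_mul_of_nonneg_right hsum hprod0]
  have h2 := le_of_mul_le_mul_left h1 hlogN
  linarith

theorem prod_id_injOn_powerset {P : Finset ℕ} (hP : ∀ p ∈ P, p.Prime) :
    Set.InjOn (fun T : Finset ℕ => ∏ p ∈ T, p) (P.powerset : Set (Finset ℕ)) := by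
  intro S hS T hT h
  have hS' : ∀ p ∈ S, p.Prime := fun p hp => hP p (Finset.mem_powerset.1 hS hp)
  have hT' : ∀ p ∈ T, p.Prime := fun p hp => hP p (Finset.mem_powerset.1 hT hp)
  rw [← Nat.primeFactors_prod hS', ← Nat.primeFactors_prod hT']
  exact congrArg Nat.primeFactors h

theorem sqrt_prod_natCast (A : Finset ℕ) :
    Real.sqrt (∏ p ∈ A, (p : ℝ)) = ∏ p ∈ A, Real.sqrt p := by
  induction A using Finset.induction_on with
  | empty => simp
  | insert a A ha ih =>
    rw [Finset.prod_insert ha, Finset.prod_insert ha, Real.sqrt_mul (Nat.cast_nonneg a), ih]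

/-- The diagonal terms of the resonance mean factor as an Euler product. -/
theorem sum_prod_le_sum_resonator_diagonal {P : Finset ℕ} (hP : ∀ p ∈ P, p.Prime) {f : ℕ → ℝ}
    (hf : ∀ p, 0 ≤ f p) {N X : ℕ} (hNX : N ≤ X) :
    ∑ T ∈ P.powerset with ∏ p ∈ T, p ≤ N, ∏ p ∈ T, (f p / Real.sqrt p + f p ^ 2) ≤
      ∑ T ∈ P.powerset with ∏ p ∈ T, p ≤ N, ∑ S ∈ P.powerset with ∏ p ∈ S, p ≤ N,
        ∑ k ∈ Finset.range X, (if (k + 1) * ∏ p ∈ S, p = ∏ p ∈ T, p then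
          (∏ p ∈ T, f p) * (∏ p ∈ S, f p) * (Real.sqrt (k + 1 : ℕ))⁻¹ else 0) := by
  refine Finset.sum_le_sum fun T hT => ?_
  obtain ⟨hTP, hTN⟩ := Finset.mem_filter.1 hT
  have hTP := Finset.mem_powerset.1 hTP
  have hposT : ∀ A ⊆ T, 0 < ∏ p ∈ A, p := fun A hA =>
    Finset.prod_pos fun p hp => (hP p (hTP (hA hp))).pos
  have hpr : ∀ A : Finset ℕ, 0 ≤ ∏ p ∈ A, f p := fun A => Finset.prod_nonneg fun p _ => hf p
  have hterm0 : ∀ S : Finset ℕ, ∀ k : ℕ, 0 ≤ (if (k + 1) * ∏ p ∈ S, p = ∏ p ∈ T, p then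
      (∏ p ∈ T, f p) * (∏ p ∈ S, f p) * (Real.sqrt (k + 1 : ℕ))⁻¹ else 0) := fun S k => by
    split_ifs
    · exact mul_nonneg (mul_nonneg (hpr T) (hpr S)) (by positivity)
    · exact le_rfl
  rw [Finset.prod_add]
  -- `A` collects the primes contributing `f p / √p`: they form `k + 1`, and the resonator index is
  -- the complement `T \ A`.
  calc _ ≤ ∑ A ∈ T.powerset, ∑ k ∈ Finset.range X,
        (if (k + 1) * ∏ p ∈ T \ A, p = ∏ p ∈ T, p then
          (∏ p ∈ T, f p) * (∏ p ∈ T \ A, f p) * (Real.sqrt (k + 1 : ℕ))⁻¹ else 0) := by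
        refine Finset.sum_le_sum fun A hA => ?_
        have hA := Finset.mem_powerset.1 hA
        have hA1 := hposT A hA
        have hAT : (∏ p ∈ A, p) * ∏ p ∈ T \ A, p = ∏ p ∈ T, p := by
          rw [mul_comm, Finset.prod_sdiff hA]
        have hAX : ∏ p ∈ A, p - 1 ∈ Finset.range X := by
          rw [Finset.mem_range]
          have : ∏ p ∈ A, p ≤ ∏ p ∈ T, p := by
            rw [← hAT]; exact Nat.le_mul_of_pos_right _ (hposT _ Finset.sdiff_subset)
          omega
        refine le_trans (le_of_eq ?_) (Finset.single_le_sum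
          (f := fun k => (if (k + 1) * ∏ p ∈ T \ A, p = ∏ p ∈ T, p then
            (∏ p ∈ T, f p) * (∏ p ∈ T \ A, f p) * (Real.sqrt (k + 1 : ℕ))⁻¹ else 0))
          (fun k _ => hterm0 _ k) hAX)
        have hk : ∏ p ∈ A, p - 1 + 1 = ∏ p ∈ A, p := Nat.sub_add_cancel hA1
        simp only [hk]
        rw [if_pos hAT, Finset.prod_div_distrib, Finset.prod_pow, Nat.cast_prod,
          sqrt_prod_natCast, ← Finset.prod_sdiff hA]
        ring
    _ = ∑ S ∈ T.powerset, ∑ k ∈ Finset.range X,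
        (if (k + 1) * ∏ p ∈ S, p = ∏ p ∈ T, p then
          (∏ p ∈ T, f p) * (∏ p ∈ S, f p) * (Real.sqrt (k + 1 : ℕ))⁻¹ else 0) := by
        refine Finset.sum_nbij' (fun A => T \ A) (fun A => T \ A) ?_ ?_ ?_ ?_ ?_
        · intro A _; exact Finset.mem_powerset.2 Finset.sdiff_subset
        · intro A _; exact Finset.mem_powerset.2 Finset.sdiff_subset
        · intro A hA; exact Finset.sdiff_sdiff_eq_self (Finset.mem_powerset.1 hA)
        · intro A hA; exact Finset.sdiff_sdiff_eq_self (Finset.mem_powerset.1 hA)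
        · intro A _; rfl
    _ ≤ _ := by
        refine Finset.sum_le_sum_of_subset_of_nonneg (fun S hS => ?_) fun S _ _ =>
          Finset.sum_nonneg fun k _ => hterm0 S k
        have hS := Finset.mem_powerset.1 hS
        refine Finset.mem_filter.2 ⟨Finset.mem_powerset.2 (hS.trans hTP), ?_⟩
        exact (Finset.prod_le_prod_of_subset_of_one_le' hS
          fun p hp _ => (hP p (hTP hp)).one_le).trans hTN

/-- The resonance method with an Euler product resonator. -/
theorem resonance_euler_product {q : ℕ} [Fact q.Prime] (H : Subgroup (DirichletCharacter ℂ q))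
    {P : Finset ℕ} (hP : ∀ p ∈ P, p.Prime) {f : ℕ → ℝ} (hf : ∀ p, 0 ≤ f p)
    {N X : ℕ} (hN : 2 ≤ N) (hNq : N < q) (hNX : N ≤ X) {ε : ℝ}
    (hsum : ∑ p ∈ P, (f p / Real.sqrt p + f p ^ 2) * Real.log p ≤ (1 - ε) * Real.log N) :
    ε * ∏ p ∈ P, (1 + f p / Real.sqrt p / (1 + f p ^ 2)) ≤
      H.index * (maxCentralValue H + 2 * (Real.sqrt q * (1 + Real.log q)) / Real.sqrt (X + 1 : ℕ) +
        2 * Real.sqrt X * N / ((q : ℝ) - 1)) := by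
  have hq2 : (2 : ℝ) ≤ q := by exact_mod_cast (Fact.out : q.Prime).two_le
  have hlog : 0 ≤ Real.log q := Real.log_natCast_nonneg q
  set E : ℝ := 2 * (Real.sqrt q * (1 + Real.log q)) / Real.sqrt (X + 1 : ℕ) with hE
  have hres := resonance_inequality H (𝒟 := P.powerset.filter fun T => ∏ p ∈ T, p ≤ N)
    (ν := fun T => ∏ p ∈ T, p) (N := N) (r := fun T => ∏ p ∈ T, f p)
    ((prod_id_injOn_powerset hP).mono (Finset.coe_subset.2 (Finset.filter_subset _ _)))
    (fun S hS => Finset.prod_pos fun p hp =>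
      (hP p (Finset.mem_powerset.1 (Finset.mem_filter.1 hS).1 hp)).pos)
    (fun S hS => (Finset.mem_filter.1 hS).2) hNq (fun S => Finset.prod_nonneg fun p _ => hf p) X
    (E := E) (V := maxCentralValue H) (by positivity)
    (fun χ hχ => norm_LFunction_half_sub_sum_le hχ
      (norm_sum_range_dirichletCharacter_le hχ) X)
    (fun χ hχ => (maxCentralValue_isGreatest H).2 ⟨χ, hχ, rfl⟩)
  have hdiag := sum_prod_le_sum_resonator_diagonal hP hf hNX
  have hmarkov := le_sum_filter_prod_le hP (w := fun p => f p / Real.sqrt p + f p ^ 2)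
    (fun p _ => add_nonneg (div_nonneg (hf p) (Real.sqrt_nonneg _)) (sq_nonneg _)) hN hsum
  have hsq : ∑ T ∈ P.powerset with ∏ p ∈ T, p ≤ N, (∏ p ∈ T, f p) ^ 2 ≤
      ∏ p ∈ P, (1 + f p ^ 2) := by
    rw [Finset.prod_one_add]
    refine le_trans (le_of_eq (Finset.sum_congr rfl fun T _ => (Finset.prod_pow _ _ _).symm))
      (Finset.sum_le_sum_of_subset_of_nonneg (Finset.filter_subset _ _) fun T _ _ =>
        Finset.prod_nonneg fun p _ => sq_nonneg _)
  -- Here the index enters: the lower bound carries `|H|`, the upper bound the full group order.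
  have hcard : (Nat.card H : ℝ) * H.index = q - 1 := by
    rw [← Nat.cast_mul, Subgroup.card_mul_index,
      DirichletCharacter.card_eq_totient_of_hasEnoughRootsOfUnity, Nat.totient_prime Fact.out,
      Nat.cast_sub (Fact.out : q.Prime).one_le, Nat.cast_one]
  have hV0 : 0 ≤ maxCentralValue H := by
    obtain ⟨χ, _, h⟩ := (maxCentralValue_isGreatest H).1
    rw [← h]
    exact norm_nonneg _
  set A := ∏ p ∈ P, (1 + f p ^ 2) with hA
  have hA0 : 0 < A := Finset.prod_pos fun p _ => by positivity
  have hsplit : ∏ p ∈ P, (1 + (f p / Real.sqrt p + f p ^ 2)) =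
      A * ∏ p ∈ P, (1 + f p / Real.sqrt p / (1 + f p ^ 2)) := by
    rw [hA, ← Finset.prod_mul_distrib]
    refine Finset.prod_congr rfl fun p _ => ?_
    have : 1 + f p ^ 2 ≠ 0 := by positivity
    field_simp
    ring
  rw [hsplit] at hmarkov
  have hcH : (0 : ℝ) < Nat.card H := by
    rw [Nat.cast_pos]
    exact Nat.card_pos
  set G := ∏ p ∈ P, (1 + f p / Real.sqrt p / (1 + f p ^ 2)) with hG
  have hq0 : (0 : ℝ) < q - 1 := by linarith
  have h1 : (Nat.card H : ℝ) * (ε * (A * G)) ≤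
      ((maxCentralValue H + E) * ((q : ℝ) - 1) + 2 * Real.sqrt X * N) * A := by
    refine (mul_le_mul_of_nonneg_left (hmarkov.trans hdiag) hcH.le).trans (hres.trans ?_)
    refine mul_le_mul_of_nonneg_left hsq ?_
    have : 0 ≤ E := by positivity
    positivity
  have h2 : (Nat.card H : ℝ) * (ε * G) ≤
      (maxCentralValue H + E) * ((q : ℝ) - 1) + 2 * Real.sqrt X * N :=
    le_of_mul_le_mul_right (by linarith) hA0
  refine le_of_mul_le_mul_left (h2.trans_eq ?_) hcH
  rw [← mul_assoc, hcard]
  field_simp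

/-! ### Chebyshev bounds and sums over primes -/

theorem eventually_le_chebyshev_theta :
    ∀ᶠ n : ℕ in atTop, 0.693 * (n : ℝ) ≤ Chebyshev.theta n := by
  have h1 : (fun x : ℝ => Real.log (x + 2)) =o[atTop] fun x => x := by
    have h := Real.isLittleO_log_id_atTop.comp_tendsto (tendsto_atTop_add_const_right atTop (2 : ℝ) tendsto_id)
    refine h.trans_isBigO (IsBigO.of_bound 3 ?_)
    filter_upwards [eventually_ge_atTop 1] with x hx
    simp only [Function.comp_apply, id, Real.norm_eq_abs]
    rw [abs_of_nonneg (by linarith), abs_of_nonneg (by linarith)]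
    linarith
  have h2 : (fun x : ℝ => Real.sqrt x * Real.log x) =o[atTop] fun x => x := by
    have h := (isLittleO_log_rpow_atTop (r := 1 / 2) (by norm_num))
    have h' := (isBigO_refl (fun x : ℝ => Real.sqrt x) atTop).mul_isLittleO h
    refine h'.congr' EventuallyEq.rfl ?_
    filter_upwards [eventually_ge_atTop 0] with x hx
    rw [← Real.sqrt_eq_rpow, Real.mul_self_sqrt hx]
  have h3 : ∀ᶠ x : ℝ in atTop, 0.693 * x ≤ Chebyshev.theta x := by
    filter_upwards [h1.bound (show (0 : ℝ) < 0.00001 by norm_num),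
      h2.bound (show (0 : ℝ) < 0.00001 by norm_num), eventually_ge_atTop 1000000] with x hx1 hx2 hx
    have h := Chebyshev.theta_ge' (x := x) (by linarith)
    rw [Real.norm_eq_abs, Real.norm_eq_abs, abs_of_nonneg (show (0 : ℝ) ≤ x by linarith)] at hx1 hx2
    have h5 := (le_abs_self _).trans hx1
    have h6 := (le_abs_self _).trans hx2
    have h7 := Real.log_two_gt_d9
    have h8 := Real.log_two_lt_d9
    nlinarith
  exact tendsto_natCast_atTop_atTop.eventually h3

theorem chebyshev_theta_natCast_succ (n : ℕ) :
    Chebyshev.theta (n + 1 : ℕ) =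
      Chebyshev.theta n + if (n + 1).Prime then Real.log (n + 1 : ℕ) else 0 := by
  rw [Chebyshev.theta_eq_sum_Icc, Chebyshev.theta_eq_sum_Icc, Nat.floor_natCast, Nat.floor_natCast,
    Finset.sum_filter, Finset.sum_filter, Finset.sum_Icc_succ_top (Nat.zero_le _)]

/-- A lower bound of Mertens type for `∑ 1 / (p log p)`, by partial summation from a lower bound
for the Chebyshev function. -/
theorem le_sum_primes_inv_mul_log {c : ℝ} (hc : 0 ≤ c) {y : ℕ} (hy : 1 ≤ y)
    (hθ : ∀ n : ℕ, y ≤ n → c * n ≤ Chebyshev.theta n) {z : ℕ} (hyz : y ≤ z) :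
    c * (1 / Real.log (y + 1 : ℕ) - 1 / Real.log (z + 1 : ℕ)) -
        Real.log 4 / Real.log (y + 1 : ℕ) ^ 2 ≤
      ∑ p ∈ Finset.Ioc y z with p.Prime, 1 / ((p : ℝ) * Real.log p) := by
  set g : ℕ → ℝ := fun n => 1 / ((n : ℝ) * Real.log n ^ 2) with hg
  have hg0 : ∀ n, 0 ≤ g n := fun n => by simp only [hg]; positivity
  have hlogpos : ∀ n : ℕ, 1 ≤ n → 0 < Real.log (n + 1 : ℕ) := fun n hn =>
    Real.log_pos (by exact_mod_cast Nat.lt_succ_of_le hn)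
  have hgsucc : ∀ n : ℕ, 1 ≤ n → g (n + 2) ≤ g (n + 1) := fun n hn => by
    have h1 := hlogpos n hn
    simp only [hg]
    gcongr <;> omega
  have hgtel : ∀ n : ℕ, 1 ≤ n →
      1 / Real.log (n + 1 : ℕ) - 1 / Real.log (n + 2 : ℕ) ≤ g (n + 1) := fun n hn => by
    have h1 := hlogpos n hn
    have h2 : Real.log (n + 1 : ℕ) ≤ Real.log (n + 2 : ℕ) :=
      Real.log_le_log (by positivity) (by push_cast; linarith)
    have h3 : 0 < Real.log (n + 2 : ℕ) := h1.trans_le h2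
    have h4 : Real.log (n + 2 : ℕ) - Real.log (n + 1 : ℕ) ≤ 1 / (n + 1 : ℕ) := by
      rw [← Real.log_div (by positivity) (by positivity)]
      refine (Real.log_le_sub_one_of_pos (by positivity)).trans (le_of_eq ?_)
      push_cast
      field_simp
      ring
    rw [div_sub_div _ _ h1.ne' h3.ne', one_mul, mul_one]
    calc (Real.log (n + 2 : ℕ) - Real.log (n + 1 : ℕ)) /
          (Real.log (n + 1 : ℕ) * Real.log (n + 2 : ℕ))
        ≤ (1 / (n + 1 : ℕ)) / (Real.log (n + 1 : ℕ) * Real.log (n + 1 : ℕ)) := by gcongr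
      _ = g (n + 1) := by simp only [hg]; rw [div_div, sq]
  -- Partial summation in a form closed under induction: the boundary term at `z` is non-negative
  -- and is dropped at the end, and the one at `y` costs the `log 4` term.
  have key : c * (1 / Real.log (y + 1 : ℕ) - 1 / Real.log (z + 1 : ℕ)) +
      (Chebyshev.theta z - c * z) * g (z + 1) - (Chebyshev.theta y - c * y) * g (y + 1) ≤
      ∑ p ∈ Finset.Ioc y z with p.Prime, 1 / ((p : ℝ) * Real.log p) := by
    induction z, hyz using Nat.le_induction with
    | base => simp
    | succ z hz ih =>
      have hz1 : 1 ≤ z := hy.trans hz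
      have hsum : ∑ p ∈ Finset.Ioc y (z + 1) with p.Prime, 1 / ((p : ℝ) * Real.log p) =
          ∑ p ∈ Finset.Ioc y z with p.Prime, 1 / ((p : ℝ) * Real.log p) +
            (Chebyshev.theta (z + 1 : ℕ) - Chebyshev.theta z) * g (z + 1) := by
        rw [Finset.sum_filter, Finset.sum_filter, Finset.sum_Ioc_succ_top hz,
          chebyshev_theta_natCast_succ, add_sub_cancel_left]
        congr 1
        have h1 := hlogpos z hz1
        split_ifs
        · simp only [hg]
          field_simp
        · simp
      rw [hsum]
      have h1 := mul_nonneg (sub_nonneg.2 (hθ (z + 1) (by omega))) (sub_nonneg.2 (hgsucc z hz1))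
      have h2 := mul_le_mul_of_nonneg_left (hgtel z hz1) hc
      push_cast at h1 h2 ih ⊢
      have e1 : (z : ℝ) + 1 + 1 = z + 2 := by ring
      rw [e1]
      nlinarith
  have h1 := mul_nonneg (sub_nonneg.2 (hθ z hyz)) (hg0 (z + 1))
  have h2 : Chebyshev.theta y * g (y + 1) ≤ Real.log 4 / Real.log (y + 1 : ℕ) ^ 2 := by
    have h3 := hlogpos y hy
    have h4 := Chebyshev.theta_le_log4_mul_x (x := (y : ℝ)) (Nat.cast_nonneg y)
    have hl4 : 0 ≤ Real.log 4 := Real.log_nonneg (by norm_num)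
    calc Chebyshev.theta y * g (y + 1) ≤ (Real.log 4 * (y + 1 : ℕ)) * g (y + 1) := by
          refine mul_le_mul_of_nonneg_right (h4.trans ?_) (hg0 _)
          gcongr
          omega
      _ = _ := by
          simp only [hg]
          have : ((y + 1 : ℕ) : ℝ) ≠ 0 := by positivity
          field_simp
  have h3 : 0 ≤ c * y * g (y + 1) := mul_nonneg (by positivity) (hg0 _)
  linarith

/-- Comparison with the harmonic sum over all integers; a power of `log x` is affordable where this
is used. -/
theorem sum_primes_inv_le {y z : ℕ} :
    ∑ p ∈ Finset.Ioc y z with p.Prime, 1 / (p : ℝ) ≤ 1 + Real.log z := by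
  have h := harmonic_le_one_add_log z
  rw [harmonic_eq_sum_Icc] at h
  push_cast at h
  refine le_trans (le_trans (Finset.sum_le_sum_of_subset_of_nonneg (t := Finset.Icc 1 z) ?_
    fun _ _ _ => by positivity) (le_of_eq (Finset.sum_congr rfl fun p _ => one_div _))) h
  intro p hp
  have := Finset.mem_Ioc.1 (Finset.mem_filter.1 hp).1
  exact Finset.mem_Icc.2 ⟨by omega, this.2⟩

/-! ### Choice of the primes and the weights -/

theorem exp_le_one_add_div {f s : ℝ} (hf0 : 0 ≤ f) (hf : f ≤ 1 / 1000) (hs : 1 ≤ s) :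
    Real.exp (0.998 * (f / s)) ≤ 1 + f / s / (1 + f ^ 2) := by
  have hv0 : 0 ≤ f / s := by positivity
  have hv : f / s ≤ 1 / 1000 := (div_le_self hf0 hs).trans hf
  set v := f / s
  have h1 : Real.exp (0.998 * v) ≤ 1 + 0.999 * v := by
    have h2 := Real.one_sub_le_exp_neg (0.998 * v)
    rw [Real.exp_neg] at h2
    have h3 : 0 < 1 - 0.998 * v := by linarith
    have h4 := (le_inv_comm₀ h3 (Real.exp_pos _)).1 h2
    refine h4.trans ?_
    rw [inv_le_iff_one_le_mul₀ h3]
    nlinarith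
  refine h1.trans ?_
  have h5 : (0 : ℝ) < 1 + f ^ 2 := by positivity
  have h6 : 0.999 * v ≤ v / (1 + f ^ 2) := by
    rw [le_div_iff₀ h5]
    have h7 : f ^ 2 ≤ (1 / 1000) ^ 2 := by gcongr
    nlinarith [mul_le_mul_of_nonneg_left h7 hv0]
  linarith

theorem eventually_ceil_rpow_bounds :
    ∀ᶠ x : ℝ in atTop, x ^ (1.005 : ℝ) ≤ (⌈x ^ (1.005 : ℝ)⌉₊ : ℝ) ∧
      Real.log (⌈x ^ (1.005 : ℝ)⌉₊ : ℝ) ≤ 1.006 * Real.log x := by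
  have h := (tendsto_rpow_atTop (show (0 : ℝ) < 0.001 by norm_num)).eventually_ge_atTop 2
  filter_upwards [h, eventually_ge_atTop 1] with x hx hx1
  have hx0 : 0 < x := by linarith
  refine ⟨Nat.le_ceil _, ?_⟩
  have h1 : 1 ≤ x ^ (1.005 : ℝ) := Real.one_le_rpow hx1 (by norm_num)
  have h2 := (Nat.ceil_lt_add_one (show 0 ≤ x ^ (1.005 : ℝ) by linarith)).le
  have h3 : x ^ (1.006 : ℝ) = x ^ (0.001 : ℝ) * x ^ (1.005 : ℝ) := by
    rw [← Real.rpow_add hx0]; norm_num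
  rw [← Real.log_rpow hx0]
  refine Real.log_le_log (by have := Nat.le_ceil (x ^ (1.005 : ℝ)); linarith) ?_
  rw [h3]
  nlinarith

set_option exponentiation.threshold 1000 in
/-- There are enough primes slightly above `x` for `∑ 1 / (p log p)` to be almost
`log 2 / log x`. -/
theorem eventually_exists_primes_sum_inv_mul_log :
    ∀ᶠ x : ℝ in atTop, ∃ P : Finset ℕ, (∀ p ∈ P, p.Prime) ∧ (∀ p ∈ P, x ^ (1.005 : ℝ) ≤ p) ∧
      0.687 / Real.log x ≤ ∑ p ∈ P, 1 / ((p : ℝ) * Real.log p) ∧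
      ∑ p ∈ P, 1 / (p : ℝ) ≤ 1 + 1006 * Real.log x := by
  obtain ⟨n₀, hn₀⟩ := eventually_atTop.1 eventually_le_chebyshev_theta
  have hY : Tendsto (fun x : ℝ => ⌈x ^ (1.005 : ℝ)⌉₊) atTop atTop :=
    tendsto_nat_ceil_atTop.comp (tendsto_rpow_atTop (by norm_num))
  have hlogY : Tendsto (fun x : ℝ => Real.log (⌈x ^ (1.005 : ℝ)⌉₊ : ℝ)) atTop atTop :=
    Real.tendsto_log_atTop.comp (tendsto_natCast_atTop_atTop.comp hY)
  filter_upwards [eventually_ceil_rpow_bounds, hY.eventually_ge_atTop (n₀ + 2),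
    hlogY.eventually_ge_atTop 20000, Real.tendsto_log_atTop.eventually_ge_atTop 1]
    with x hb hx1 hx2 hx3
  set Y := ⌈x ^ (1.005 : ℝ)⌉₊
  obtain ⟨y, hy⟩ : ∃ y, Y = y + 1 := ⟨Y - 1, by omega⟩
  have hYpow : 1 ≤ Y ^ 1000 := Nat.one_le_pow _ _ (by omega)
  -- The exponent `1000` makes the upper endpoint cost only a factor `0.999`, whence `0.692307 =
  -- 0.999 * 0.693` below.
  obtain ⟨z, hz⟩ : ∃ z, Y ^ 1000 = z + 1 := ⟨Y ^ 1000 - 1, by omega⟩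
  have hyz : y ≤ z := by
    have : Y ≤ Y ^ 1000 := Nat.le_self_pow (by norm_num) Y
    omega
  refine ⟨(Finset.Ioc y z).filter Nat.Prime, fun p hp => (Finset.mem_filter.1 hp).2,
    fun p hp => ?_, ?_, ?_⟩
  · have := (Finset.mem_Ioc.1 (Finset.mem_filter.1 hp).1).1
    refine hb.1.trans ?_
    exact_mod_cast (by omega : Y ≤ p)
  · have h := le_sum_primes_inv_mul_log (c := 0.693) (by norm_num) (show 1 ≤ y by omega)
      (fun n hn => hn₀ n (by omega)) hyz
    rw [← hy, ← hz, Nat.cast_pow, Real.log_pow] at h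
    refine le_trans ?_ h
    set ℓ := Real.log (Y : ℝ)
    have hl4 : Real.log 4 ≤ 2 := by
      have : Real.log 4 = 2 * Real.log 2 := by
        rw [show (4 : ℝ) = 2 ^ 2 by norm_num, Real.log_pow]; norm_num
      linarith [Real.log_two_lt_d9]
    have hℓ : 0 < ℓ := by linarith
    have e1 : 0.693 * (1 / ℓ - 1 / (((1000 : ℕ) : ℝ) * ℓ)) - Real.log 4 / ℓ ^ 2 =
        (0.692307 - Real.log 4 / ℓ) / ℓ := by
      push_cast
      field_simp
      ring
    have h1 : Real.log 4 / ℓ ≤ 0.0001 := by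
      rw [div_le_iff₀ hℓ]; linarith
    rw [e1, div_le_div_iff₀ (by linarith) hℓ]
    nlinarith [hb.2]
  · refine sum_primes_inv_le.trans ?_
    have h1 : Real.log z ≤ 1000 * Real.log Y := by
      rcases Nat.eq_zero_or_pos z with h0 | h0
      · rw [h0]; simp; linarith
      · have h2 : Real.log z ≤ Real.log ((Y ^ 1000 : ℕ) : ℝ) :=
          Real.log_le_log (by exact_mod_cast h0) (by rw [hz]; push_cast; linarith)
        rw [Nat.cast_pow, Real.log_pow] at h2
        exact_mod_cast h2
    linarith [hb.2]

theorem tendsto_div_log_atTop : Tendsto (fun x : ℝ => x / Real.log x) atTop atTop := by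
  have h := Real.tendsto_exp_div_pow_atTop 1
  refine (h.comp Real.tendsto_log_atTop).congr' ?_
  filter_upwards [eventually_gt_atTop 0] with x hx
  simp [Real.exp_log hx]

/-- An Euler product resonator whose gain exceeds `exp ((1 / √3) √(x / log x))`. -/
theorem eventually_exists_resonator :
    ∀ᶠ x : ℝ in atTop, ∃ (P : Finset ℕ) (f : ℕ → ℝ), (∀ p ∈ P, p.Prime) ∧ (∀ p, 0 ≤ f p) ∧
      ∑ p ∈ P, (f p / Real.sqrt p + f p ^ 2) * Real.log p ≤ 0.491 * x ∧
      Real.exp (0.5788 * Real.sqrt (x / Real.log x)) ≤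
        ∏ p ∈ P, (1 + f p / Real.sqrt p / (1 + f p ^ 2)) := by
  have hsmall₁ : ∀ᶠ x : ℝ in atTop, Real.log x ≤ 1e-6 * x ^ (0.005 : ℝ) := by
    filter_upwards [(isLittleO_log_rpow_atTop (show (0 : ℝ) < 0.005 by norm_num)).bound
      (show (0 : ℝ) < 1e-6 by norm_num), eventually_ge_atTop 1] with x hx hx1
    rw [Real.norm_eq_abs, Real.norm_eq_abs, abs_of_nonneg (Real.rpow_nonneg (by linarith) _)] at hx
    exact (le_abs_self _).trans hx
  have hsmall₂ : ∀ᶠ x : ℝ in atTop,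
      x * Real.log x * (1 + 1006 * Real.log x) ^ 2 ≤ (0.001 * x) ^ 2 := by
    filter_upwards [(isLittleO_log_rpow_atTop (show (0 : ℝ) < 1 / 3 by norm_num)).bound
      (show (0 : ℝ) < 1e-5 by norm_num), Real.tendsto_log_atTop.eventually_ge_atTop 1,
      eventually_ge_atTop 1] with x hx hlog hx1
    rw [Real.norm_eq_abs, Real.norm_eq_abs, abs_of_nonneg (Real.rpow_nonneg (by linarith) _)] at hx
    have h1 := (le_abs_self _).trans hx
    have h2 : Real.log x ^ 3 ≤ 1e-15 * x := by
      calc Real.log x ^ 3 ≤ (1e-5 * x ^ (1 / 3 : ℝ)) ^ 3 := by gcongr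
        _ = 1e-15 * x := by
          rw [mul_pow, ← Real.rpow_natCast (x ^ (1 / 3 : ℝ)) 3, ← Real.rpow_mul (by linarith)]
          norm_num
    have h3 : (1 + 1006 * Real.log x) ^ 2 ≤ (1007 * Real.log x) ^ 2 := by
      gcongr
      linarith
    calc x * Real.log x * (1 + 1006 * Real.log x) ^ 2
        ≤ x * Real.log x * (1007 * Real.log x) ^ 2 := by gcongr
      _ = 1007 ^ 2 * x * Real.log x ^ 3 := by ring
      _ ≤ 1007 ^ 2 * x * (1e-15 * x) := by gcongr
      _ ≤ (0.001 * x) ^ 2 := by nlinarith [sq_nonneg x]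
  filter_upwards [eventually_exists_primes_sum_inv_mul_log, hsmall₁, hsmall₂,
    eventually_ge_atTop 3, Real.tendsto_log_atTop.eventually_ge_atTop 1]
    with x ⟨P, hP, hPx, hS, hT⟩ hs₁ hs₂ hx3 hlog
  have hx0 : 0 < x := by linarith
  set S := ∑ p ∈ P, 1 / ((p : ℝ) * Real.log p) with hSdef
  have hlog0 : 0 < Real.log x := by linarith
  have hS0 : 0 < S := lt_of_lt_of_le (by positivity) hS
  -- Chosen so that `∑ f p ^ 2 * log p = lam ^ 2 * S` is exactly `0.49 * x`. The shape of `f` below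
  -- is the Cauchy–Schwarz optimum for `∑ f p / √p` under this constraint.
  set lam := Real.sqrt (0.49 * x / S) with hlam
  have hlam0 : 0 ≤ lam := Real.sqrt_nonneg _
  have hlamsq : lam ^ 2 = 0.49 * x / S := Real.sq_sqrt (by positivity)
  have hlamsq_le : lam ^ 2 ≤ x * Real.log x := by
    rw [hlamsq, div_le_iff₀ hS0]
    rw [div_le_iff₀ hlog0] at hS
    nlinarith
  set f : ℕ → ℝ := fun p => lam / (Real.sqrt p * Real.log p) with hf
  have hf0 : ∀ p, 0 ≤ f p := fun p =>
    div_nonneg hlam0 (mul_nonneg (Real.sqrt_nonneg _) (Real.log_natCast_nonneg p))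
  have hlogp : ∀ p ∈ P, 1 ≤ Real.log p := fun p hp => by
    refine hlog.trans (Real.log_le_log hx0 (le_trans ?_ (hPx p hp)))
    exact Real.self_le_rpow_of_one_le (by linarith) (by norm_num)
  have hp0 : ∀ p ∈ P, (0 : ℝ) < p := fun p hp => Nat.cast_pos.2 (hP p hp).pos
  have hfs : ∀ p ∈ P, f p / Real.sqrt p = lam * (1 / ((p : ℝ) * Real.log p)) := fun p hp => by
    have h1 := hp0 p hp
    have h2 := hlogp p hp
    simp only [hf]
    rw [div_div, mul_right_comm, Real.mul_self_sqrt h1.le, mul_one_div]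
  have hfsq : ∀ p ∈ P, f p ^ 2 = lam ^ 2 / (p * Real.log p ^ 2) := fun p hp => by
    simp only [hf]
    rw [div_pow, mul_pow, Real.sq_sqrt (hp0 p hp).le]
  -- The reason for starting at `x ^ 1.005`: there `p` dominates `lam ^ 2 ≤ x log x`.
  have hfle : ∀ p ∈ P, f p ≤ 1 / 1000 := fun p hp => by
    refine le_of_sq_le_sq ?_ (by norm_num)
    have h2 := hlogp p hp
    have h3 := hp0 p hp
    rw [hfsq p hp, div_le_iff₀ (by positivity)]
    have h4 : x * Real.log x ≤ 1e-6 * p := by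
      calc x * Real.log x ≤ x * (1e-6 * x ^ (0.005 : ℝ)) := by gcongr
        _ = 1e-6 * x ^ (1.005 : ℝ) := by
          rw [show (1.005 : ℝ) = 1 + 0.005 by norm_num, Real.rpow_add hx0, Real.rpow_one]
          ring
        _ ≤ 1e-6 * p := by
          gcongr
          exact hPx p hp
    nlinarith [mul_le_mul_of_nonneg_left (one_le_pow₀ (n := 2) h2) h3.le]
  refine ⟨P, f, hP, hf0, ?_, ?_⟩
  · have h1 : ∑ p ∈ P, (f p / Real.sqrt p + f p ^ 2) * Real.log p =
        lam * ∑ p ∈ P, 1 / (p : ℝ) + lam ^ 2 * S := by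
      rw [hSdef, Finset.mul_sum, Finset.mul_sum, ← Finset.sum_add_distrib]
      refine Finset.sum_congr rfl fun p hp => ?_
      have h2 := hlogp p hp
      have h3 := hp0 p hp
      rw [hfs p hp, hfsq p hp]
      field_simp
    have h2 : lam ^ 2 * S = 0.49 * x := by
      rw [hlamsq]; field_simp
    have h3 : lam * (1 + 1006 * Real.log x) ≤ 0.001 * x := by
      refine le_of_sq_le_sq ?_ (by positivity)
      rw [mul_pow]
      exact (mul_le_mul_of_nonneg_right hlamsq_le (sq_nonneg _)).trans hs₂
    have h4 := mul_le_mul_of_nonneg_left hT hlam0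
    rw [h1, h2]
    linarith
  · have h1 : ∏ p ∈ P, Real.exp (0.998 * (f p / Real.sqrt p)) ≤
        ∏ p ∈ P, (1 + f p / Real.sqrt p / (1 + f p ^ 2)) := by
      refine Finset.prod_le_prod (fun _ _ => (Real.exp_pos _).le) fun p hp => ?_
      refine exp_le_one_add_div (hf0 p) (hfle p hp) ?_
      rw [Real.one_le_sqrt]
      exact_mod_cast (hP p hp).one_le
    refine le_trans ?_ h1
    rw [← Real.exp_sum, Real.exp_le_exp, ← Finset.mul_sum, Finset.sum_congr rfl hfs,
      ← Finset.mul_sum, ← hSdef]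
    -- `lam * S = √(0.49 x S)` and `0.49 * 0.687 = 0.33663 > 0.58 ^ 2`; then `0.998 * 0.58 >
    -- 0.5788`.
    have h2 : 0.58 * Real.sqrt (x / Real.log x) ≤ lam * S := by
      refine le_of_sq_le_sq ?_ (by positivity)
      have h3 : (lam * S) ^ 2 = 0.49 * x * S := by
        rw [mul_pow, hlamsq]; field_simp
      rw [h3, mul_pow, Real.sq_sqrt (by positivity)]
      calc 0.58 ^ 2 * (x / Real.log x) ≤ 0.49 * x * (0.687 / Real.log x) := by
            have h4 : 0 ≤ x / Real.log x := by positivity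
            have e : 0.49 * x * (0.687 / Real.log x) = 0.33663 * (x / Real.log x) := by ring
            rw [e]
            nlinarith
        _ ≤ _ := by gcongr
    have h3 := Real.sqrt_nonneg (x / Real.log x)
    linarith

/-! ### Lengths, error terms and the conclusion -/

/-- For the lengths `X = ⌊q ^ 1.005⌋` and `N = ⌊q ^ 0.495⌋`, the truncation error of the central
values and the contribution of the principal character are negligible. -/
theorem eventually_error_terms_le :
    ∀ᶠ x : ℝ in atTop, 1 ≤ x ∧
      2 * (Real.sqrt x * (1 + Real.log x)) / Real.sqrt ((⌊x ^ (1.005 : ℝ)⌋₊ + 1 : ℕ) : ℝ) +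
        2 * Real.sqrt (⌊x ^ (1.005 : ℝ)⌋₊ : ℝ) * (⌊x ^ (0.495 : ℝ)⌋₊ : ℝ) / (x - 1) ≤ 1 := by
  filter_upwards [(isLittleO_log_rpow_atTop (show (0 : ℝ) < 0.0025 by norm_num)).bound
    (show (0 : ℝ) < 0.1 by norm_num),
    (tendsto_rpow_atTop (show (0 : ℝ) < 0.0025 by norm_num)).eventually_ge_atTop 10,
    eventually_ge_atTop 2] with x hx hx10 hx2
  have hx0 : 0 < x := by linarith
  rw [Real.norm_eq_abs, Real.norm_eq_abs, abs_of_nonneg (Real.rpow_nonneg hx0.le _)] at hx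
  have hlog := (le_abs_self _).trans hx
  -- Both errors save `x ^ 0.0025`: the first since `√X` beats `√x` by it, the second since `0.5025
  -- + 0.495 = 1 - 0.0025`.
  have hs : Real.sqrt (x ^ (1.005 : ℝ)) = Real.sqrt x * x ^ (0.0025 : ℝ) := by
    rw [Real.sqrt_eq_rpow, Real.sqrt_eq_rpow, ← Real.rpow_mul hx0.le, ← Real.rpow_add hx0]
    norm_num
  have hsx : 0 < Real.sqrt x := Real.sqrt_pos.2 hx0
  have hd : 0 < x ^ (0.0025 : ℝ) := Real.rpow_pos_of_pos hx0 _
  refine ⟨by linarith, ?_⟩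
  have h1 : 2 * (Real.sqrt x * (1 + Real.log x)) /
      Real.sqrt ((⌊x ^ (1.005 : ℝ)⌋₊ + 1 : ℕ) : ℝ) ≤ 1 / 2 := by
    have h2 : Real.sqrt x * x ^ (0.0025 : ℝ) ≤
        Real.sqrt ((⌊x ^ (1.005 : ℝ)⌋₊ + 1 : ℕ) : ℝ) := by
      rw [← hs]
      refine Real.sqrt_le_sqrt ?_
      push_cast
      exact (Nat.lt_floor_add_one _).le
    rw [div_le_iff₀ (lt_of_lt_of_le (by positivity) h2)]
    nlinarith
  have h3 : 2 * Real.sqrt (⌊x ^ (1.005 : ℝ)⌋₊ : ℝ) * (⌊x ^ (0.495 : ℝ)⌋₊ : ℝ) / (x - 1) ≤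
      1 / 2 := by
    have h4 : Real.sqrt (⌊x ^ (1.005 : ℝ)⌋₊ : ℝ) ≤ Real.sqrt (x ^ (1.005 : ℝ)) :=
      Real.sqrt_le_sqrt (Nat.floor_le (Real.rpow_nonneg hx0.le _))
    have h5 : (⌊x ^ (0.495 : ℝ)⌋₊ : ℝ) ≤ x ^ (0.495 : ℝ) :=
      Nat.floor_le (Real.rpow_nonneg hx0.le _)
    have h6 : Real.sqrt (x ^ (1.005 : ℝ)) * x ^ (0.495 : ℝ) * x ^ (0.0025 : ℝ) = x := by
      rw [Real.sqrt_eq_rpow, ← Real.rpow_mul hx0.le, ← Real.rpow_add hx0, ← Real.rpow_add hx0]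
      norm_num
    have h7 := mul_le_mul h4 h5 (Nat.cast_nonneg _) (Real.sqrt_nonneg _)
    have h8 : 0 ≤ Real.sqrt (x ^ (1.005 : ℝ)) * x ^ (0.495 : ℝ) :=
      mul_nonneg (Real.sqrt_nonneg _) (Real.rpow_nonneg hx0.le _)
    rw [div_le_iff₀ (by linarith)]
    nlinarith
  linarith

theorem eventually_le_log_floor_rpow :
    ∀ᶠ x : ℝ in atTop, 2 ≤ ⌊x ^ (0.495 : ℝ)⌋₊ ∧
      0.494 * Real.log x ≤ Real.log (⌊x ^ (0.495 : ℝ)⌋₊ : ℝ) := by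
  filter_upwards [(tendsto_rpow_atTop (show (0 : ℝ) < 0.495 by norm_num)).eventually_ge_atTop 2,
    (tendsto_rpow_atTop (show (0 : ℝ) < 0.001 by norm_num)).eventually_ge_atTop 2,
    eventually_ge_atTop 1] with x h1 h2 hx
  have hx0 : 0 < x := by linarith
  refine ⟨Nat.le_floor (by exact_mod_cast h1), ?_⟩
  have h3 : x ^ (0.495 : ℝ) = x ^ (0.494 : ℝ) * x ^ (0.001 : ℝ) := by
    rw [← Real.rpow_add hx0]; norm_num
  have h4 := Nat.lt_floor_add_one (x ^ (0.495 : ℝ))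
  have h5 : 1 ≤ x ^ (0.494 : ℝ) := Real.one_le_rpow hx (by norm_num)
  rw [← Real.log_rpow hx0]
  refine Real.log_le_log (by linarith) ?_
  nlinarith

theorem tendsto_resonanceScale : Tendsto resonanceScale atTop atTop :=
  Real.tendsto_sqrt_atTop.comp (tendsto_div_log_atTop.comp
    (Real.tendsto_log_atTop.comp tendsto_natCast_atTop_atTop))

/-- For large primes `q`, the resonance method bounds the central values over any group of
characters in terms of its index. -/
theorem eventually_exp_resonanceScale_le_index_mul :
    ∀ᶠ q : ℕ in atTop, ∀ [Fact q.Prime] (H : Subgroup (DirichletCharacter ℂ q)),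
      0.001 * Real.exp (0.5788 * resonanceScale q) ≤ H.index * (maxCentralValue H + 1) := by
  filter_upwards [tendsto_natCast_atTop_atTop.eventually eventually_error_terms_le,
    tendsto_natCast_atTop_atTop.eventually eventually_le_log_floor_rpow,
    (Real.tendsto_log_atTop.comp tendsto_natCast_atTop_atTop).eventually
      eventually_exists_resonator, eventually_ge_atTop 2]
    with q herr hN ⟨P, f, hP, hf, hsum, hgain⟩ hq2 _ H
  have hq1 : (1 : ℝ) < q := by exact_mod_cast hq2
  have hlog : 0 < Real.log q := Real.log_pos hq1
  have hNq : ⌊(q : ℝ) ^ (0.495 : ℝ)⌋₊ < q := by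
    rw [Nat.floor_lt (Real.rpow_nonneg (by linarith) _)]
    calc (q : ℝ) ^ (0.495 : ℝ) < (q : ℝ) ^ (1 : ℝ) := Real.rpow_lt_rpow_of_exponent_lt hq1 (by norm_num)
      _ = q := Real.rpow_one _
  have hNX : ⌊(q : ℝ) ^ (0.495 : ℝ)⌋₊ ≤ ⌊(q : ℝ) ^ (1.005 : ℝ)⌋₊ :=
    Nat.floor_mono (Real.rpow_le_rpow_of_exponent_le hq1.le (by norm_num))
  -- Admissible because `0.491 ≤ 0.999 * 0.494`.
  have h := resonance_euler_product H hP hf hN.1 hNq hNX (ε := 0.001) (by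
    simp only [Function.comp_apply] at hsum
    linarith [hN.2])
  refine (mul_le_mul_of_nonneg_left hgain (by norm_num)).trans (h.trans ?_)
  refine mul_le_mul_of_nonneg_left ?_ (Nat.cast_nonneg _)
  linarith [herr.2]

theorem theorem1 {ι : Type*} (l : Filter ι) (q : ι → ℕ) [∀ i, Fact (q i).Prime]
    (H : ∀ i, Subgroup (DirichletCharacter ℂ (q i)))
    (hq : Tendsto q l atTop)
    (hH : (fun i => Real.log ((H i).index : ℝ)) =o[l] (fun i => resonanceScale (q i))) :
    ∃ e : ι → ℝ, e =o[l] (fun _ => (1 : ℝ)) ∧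
      ∀ᶠ i in l,
        Real.exp ((1 / Real.sqrt 3 + e i) * resonanceScale (q i)) ≤ maxCentralValue (H i) := by
  refine ⟨fun _ => 0, isLittleO_zero _ _, ?_⟩
  filter_upwards [hq.eventually eventually_exp_resonanceScale_le_index_mul,
    hH.bound (show (0 : ℝ) < 0.0005 by norm_num),
    (tendsto_resonanceScale.comp hq).eventually_ge_atTop 20000000] with i hi hind hL
  have hi := hi (H i)
  simp only [Function.comp_apply] at hL
  set L := resonanceScale (q i)
  set V := maxCentralValue (H i)
  have hidx : (0 : ℝ) < (H i).index := Nat.cast_pos.2 (Nat.pos_of_ne_zero Subgroup.index_ne_zero_of_finite)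
  have hidx_le : ((H i).index : ℝ) ≤ Real.exp (0.0005 * L) := by
    rw [← Real.log_le_iff_le_exp hidx]
    rw [Real.norm_eq_abs, Real.norm_eq_abs, abs_of_nonneg (show 0 ≤ L by linarith)] at hind
    exact (le_abs_self _).trans hind
  have hsqrt : 1 / Real.sqrt 3 ≤ 0.5775 := by
    rw [div_le_iff₀ (by positivity)]
    have : (1.732 : ℝ) ≤ Real.sqrt 3 := Real.le_sqrt_of_sq_le (by norm_num)
    linarith
  have hV : 0 < V + 1 := by
    by_contra hneg
    have h1 := Real.exp_pos (0.5788 * L)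
    nlinarith
  have h1 : 0.001 * Real.exp (0.5788 * L) ≤ Real.exp (0.0005 * L) * (V + 1) :=
    hi.trans (mul_le_mul_of_nonneg_right hidx_le hV.le)
  -- The exponent splits into the index (`0.0005`), the target (`0.5775 ≥ 1 / √3`), and a surplus
  -- (`0.0008`) absorbing the factor `0.001` and the `+ 1`.
  have h2 : Real.exp (0.5788 * L) =
      Real.exp (0.0005 * L) * (Real.exp (0.5775 * L) * Real.exp (0.0008 * L)) := by
    rw [← Real.exp_add, ← Real.exp_add]
    congr 1
    ring
  have h3 : 0.001 * (Real.exp (0.5775 * L) * Real.exp (0.0008 * L)) ≤ V + 1 := by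
    refine le_of_mul_le_mul_left ?_ (Real.exp_pos (0.0005 * L))
    rw [h2] at h1
    linarith
  have h4 : 2000 ≤ Real.exp (0.0008 * L) := by
    have := Real.add_one_le_exp (0.0008 * L)
    linarith
  have h5 : 1 ≤ Real.exp (0.5775 * L) := Real.one_le_exp (by linarith)
  have h6 : Real.exp ((1 / Real.sqrt 3 + 0) * L) ≤ Real.exp (0.5775 * L) := by
    rw [Real.exp_le_exp, add_zero]
    gcongr
  nlinarith
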